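/- Let $M$ be a paracompact smooth manifold of finite dimension, $\pi:\mathcal TM\to M$ the bundle of nonzero tangent vectors, and $\pi^{-1}(TM)\to\mathcal TM$ the pullback of $TM$; smooth sections of $\pi^{-1}(TM)$ are called $\pi$-vector fields. Let $\rho=(\pi_{\mathcal TM},d\pi):T\mathcal TM\to\pi^{-1}(TM)$, let $\gamma:\pi^{-1}(TM)\to T\mathcal TM$ be the vertical lift, and let $\overline\eta(u)=(u,u)$ be the fundamental $\pi$-vector field. A Finsler structure is a continuous function $L:TM\to\mathbb R$ which is smooth and positive on $\mathcal TM$, positively homogeneous of degree one on each tangent space, and whose metric on $\pi^{-1}(TM)$, $g_u(v,w)=\frac12\frac{\partial^2}{\partial s\,\partial t}L^2(u+sv+tw)|_{s=t=0}$, is positive definite. A smooth linear connection $D$ on $\pi^{-1}(TM)$ is regular if $T_u\mathcal TM=\ker\rho_u\oplus\ker(X\mapsto D_X\overline\eta)_u$ for all $u\in\mathcal TM$; its horizontal map $\beta$ is then the inverse of the restriction of $\rho$ to the horizontal spaces $\ker(X\mapsto D_X\overline\eta)$. Put $\mathbf T(X,Y)=D_X\rho Y-D_Y\rho X-\rho[X,Y]$.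 The Cartan connection of $(M,L)$ is the regular connection $\nabla$ on $\pi^{-1}(TM)$ such that $\nabla g=0$, $\mathbf T(\beta\overline X,\beta\overline Y)=0$, and $T(\overline X,\overline Y):=\mathbf T(\gamma\overline X,\beta\overline Y)$ satisfies $g(T(\overline X,\overline Y),\overline Z)=g(T(\overline X,\overline Z),\overline Y)$. Let $(M,L)$ be a Finsler manifold with Cartan connection $\nabla$ and let $\overline\zeta$ be a concurrent $\pi$-vector field, i.e. $\nabla_X\overline\zeta=-\rho X$ for all $X$. Put $B=g(\overline\zeta,\overline\eta)$ and $p^2=g(\overline\zeta,\overline\zeta)$, and let $(M,\widetilde L)$ be a Finsler manifold, with Cartan connection $\widetilde\nabla$, such that $\widetilde L^2=L^2+B^2$ on $\mathcal TM$. Then for all vector fields $X,Y$ on $\mathcal TM$ $$\widetilde\nabla_X\rho Y=\nabla_X\rho Y-\frac{g(\rho X,\rho Y)}{1+p^2}\,\overline\zeta .$$ In particular, for all $\pi$-vector fields $\overline X,\overline Y$, (a) $\widetilde\nabla_{\gamma\overline X}\overline Y=\nabla_{\gamma\overline X}\overline Y$; (b) $\widetilde\nabla_{\widetilde\beta\overline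 X}\overline Y=\nabla_{\beta\overline X}\overline Y-U(\overline X,\overline Y)$, where $U(\overline X,\overline Y)=\dfrac{g(\overline X,\overline Y)}{1+p^2}\,\overline\zeta-\dfrac{g(\overline X,\overline\eta)}{1+p^2}\,\nabla_{\gamma\overline\zeta}\overline Y$, and $\beta,\widetilde\beta$ are the horizontal maps of $\nabla,\widetilde\nabla$. -/

import Mathlib

open Bundle Manifold
open scoped Manifold ContDiff Topology

noncomputable section

namespace Finsler

variable {E : Type*} [NormedAddCommGroup E] [NormedSpace ℝ E]
  {M : Type*} [TopologicalSpace M] [ChartedSpace E M] [IsManifold 𝓘(ℝ, E) ∞ M]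

/-! ### The slit tangent bundle and the pullback bundle -/

variable (E M) in
/-- The projection `TM → M`, as a smooth map. -/
def projTM : C^∞⟮𝓘(ℝ, E).tangent, TangentBundle 𝓘(ℝ, E) M; 𝓘(ℝ, E), M⟯ :=
  ⟨TotalSpace.proj, contMDiff_proj (TangentSpace 𝓘(ℝ, E) : M → Type _)⟩

variable (E M) in
/-- The pullback of the tangent bundle by the projection `π : TM → M`; its fibre over `u` is
`T_{π u} M`. Only its restriction to the slit tangent bundle matters below. -/
abbrev PiTM : TangentBundle 𝓘(ℝ, E) M → Type _ :=
  (projTM E M) *ᵖ (TangentSpace 𝓘(ℝ, E) : M → Type _)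

instance instAddCommGroupPiTM (u : TangentBundle 𝓘(ℝ, E) M) : AddCommGroup (PiTM E M u) :=
  inferInstanceAs (AddCommGroup (TangentSpace 𝓘(ℝ, E) u.proj))

instance instIsTopologicalAddGroupPiTM (u : TangentBundle 𝓘(ℝ, E) M) :
    IsTopologicalAddGroup (PiTM E M u) :=
  inferInstanceAs (IsTopologicalAddGroup (TangentSpace 𝓘(ℝ, E) u.proj))

instance instContinuousSMulPiTM (u : TangentBundle 𝓘(ℝ, E) M) :
    ContinuousSMul ℝ (PiTM E M u) :=
  inferInstanceAs (ContinuousSMul ℝ (TangentSpace 𝓘(ℝ, E) u.proj))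

variable (E M) in
/-- The set of nonzero tangent vectors. Vector fields, `π`-vector fields and connections are
represented by objects defined over all of `TM`, whose values on the zero section are irrelevant:
conditions are imposed, and conclusions are drawn, on the slit tangent bundle only. -/
def slit : Set (TangentBundle 𝓘(ℝ, E) M) := {u | u.2 ≠ 0}

/-- `Y` is a smooth `π`-vector field: a smooth section of the pullback bundle over the slit tangent
bundle. -/
def IsSmoothPiField (Y : Π u : TangentBundle 𝓘(ℝ, E) M, PiTM E M u) : Prop :=
  ContMDiffOn 𝓘(ℝ, E).tangent (𝓘(ℝ, E).tangent.prod 𝓘(ℝ, E)) ∞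
    (fun u ↦ (⟨u, Y u⟩ : TotalSpace E (PiTM E M))) (slit E M)

/-- `X` is a smooth vector field on the slit tangent bundle. -/
def IsSmoothField (X : Π u : TangentBundle 𝓘(ℝ, E) M, TangentSpace 𝓘(ℝ, E).tangent u) : Prop :=
  ContMDiffOn 𝓘(ℝ, E).tangent 𝓘(ℝ, E).tangent.tangent ∞
    (fun u ↦ (⟨u, X u⟩ : TangentBundle 𝓘(ℝ, E).tangent (TangentBundle 𝓘(ℝ, E) M))) (slit E M)

/-- The inclusion of the fibre `T_x M` into `TM`. As a vector space, `T_x M` is the model space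
`E`. -/
def fibreIncl (x : M) (w : E) : TangentBundle 𝓘(ℝ, E) M := ⟨x, w⟩

/-- A tangent vector `u`, as an element of the model space `E = T_{π u} M`. -/
def fibreCoord (u : TangentBundle 𝓘(ℝ, E) M) : E := u.2

/-- The fundamental `π`-vector field `u ↦ (u, u)`. -/
def eta (u : TangentBundle 𝓘(ℝ, E) M) : PiTM E M u := u.2

/-- The bundle map `ρ = (π_{TM}, dπ) : T(TM) → π⁻¹(TM)`. -/
def rho (u : TangentBundle 𝓘(ℝ, E) M) : TangentSpace 𝓘(ℝ, E).tangent u →L[ℝ] PiTM E M u :=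
  mfderiv 𝓘(ℝ, E).tangent 𝓘(ℝ, E) (projTM E M) u

/-- The bundle map `γ : π⁻¹(TM) → T(TM)`: the vertical lift, that is, the differential at `u` of the
inclusion of the fibre `T_{π u} M` (identified with its own tangent space) into `TM`. -/
def gamma (u : TangentBundle 𝓘(ℝ, E) M) : PiTM E M u →L[ℝ] TangentSpace 𝓘(ℝ, E).tangent u :=
  mfderiv 𝓘(ℝ, E) 𝓘(ℝ, E).tangent (fibreIncl u.proj) (fibreCoord u)

/-! ### Finsler structures -/

/-- The Hessian of the energy `½ L²` restricted to the fibre `T_{π u} M = E`, at the point `u`. -/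
def energyHessian (L : TangentBundle 𝓘(ℝ, E) M → ℝ) (u : TangentBundle 𝓘(ℝ, E) M) :
    E →L[ℝ] E →L[ℝ] ℝ :=
  fderiv ℝ (fderiv ℝ (fun w : E ↦ (1 / 2 : ℝ) * L (fibreIncl u.proj w) ^ 2)) (fibreCoord u)

/-- The metric on the pullback bundle defined by `L`, that is
`g_u(v, w) = ½ ∂²/∂s∂t L²(u + s v + t w)` at `s = t = 0`. -/
def metric (L : TangentBundle 𝓘(ℝ, E) M → ℝ) (u : TangentBundle 𝓘(ℝ, E) M) :
    PiTM E M u →L[ℝ] PiTM E M u →L[ℝ] ℝ :=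
  energyHessian (E := E) L u

/-- `L` is a Finsler structure on `M`: continuous on `TM`, smooth and positive on nonzero vectors,
positively homogeneous of degree one on each tangent space, with positive definite metric. -/
structure IsFinsler (L : TangentBundle 𝓘(ℝ, E) M → ℝ) : Prop where
  continuous : Continuous L
  smooth : ContMDiffOn 𝓘(ℝ, E).tangent 𝓘(ℝ, ℝ) ∞ L (slit E M)
  pos : ∀ u ∈ slit E M, 0 < L u
  homogeneous : ∀ (x : M) (y : TangentSpace 𝓘(ℝ, E) x) (t : ℝ), 0 < t →
    L ⟨x, t • y⟩ = t * L ⟨x, y⟩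
  posDef : ∀ u ∈ slit E M, ∀ v : PiTM E M u, v ≠ 0 → 0 < metric L u v v

/-! ### Connections on the pullback bundle -/

variable (E M) in
/-- The raw type of connections on the pullback bundle: `D Y u X` stands for `(D_X Y)(u)`, where `X`
is a tangent vector to `TM` at `u`. -/
abbrev PreConnection : Type _ :=
  (Π u : TangentBundle 𝓘(ℝ, E) M, PiTM E M u) →
    Π u : TangentBundle 𝓘(ℝ, E) M, TangentSpace 𝓘(ℝ, E).tangent u →L[ℝ] PiTM E M u

/-- `D` is a smooth linear connection on the pullback bundle over the slit tangent bundle. -/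
structure IsConnection (D : PreConnection E M) : Prop where
  isCovariantDerivativeOn : IsCovariantDerivativeOn E D (slit E M)
  smooth : ContMDiffCovariantDerivativeOn E ∞ D (slit E M)

/-- The vertical space at `u`. -/
def vertical (u : TangentBundle 𝓘(ℝ, E) M) : Submodule ℝ (TangentSpace 𝓘(ℝ, E).tangent u) :=
  LinearMap.ker (rho u).toLinearMap

/-- The horizontal space of `D` at `u`: the kernel of the connection map `K : X ↦ D_X η`. -/
def horizontal (D : PreConnection E M) (u : TangentBundle 𝓘(ℝ, E) M) :
    Submodule ℝ (TangentSpace 𝓘(ℝ, E).tangent u) :=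
  LinearMap.ker (D eta u).toLinearMap

/-- `D` is regular: tangent spaces are the direct sums of their vertical and horizontal spaces. -/
def IsRegular (D : PreConnection E M) : Prop :=
  ∀ u ∈ slit E M, IsCompl (vertical u) (horizontal D u)

/-- The horizontal map `β` of a regular connection `D`: the inverse of the restriction of `ρ` to the
horizontal space. -/
def beta (D : PreConnection E M) (u : TangentBundle 𝓘(ℝ, E) M) (v : PiTM E M u) :
    TangentSpace 𝓘(ℝ, E).tangent u :=
  Function.invFunOn (rho u) (horizontal D u : Set (TangentSpace 𝓘(ℝ, E).tangent u)) v

/-- The classical torsion `𝐓(X, Y) = D_X ρY - D_Y ρX - ρ[X, Y]`. -/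
def torsion (D : PreConnection E M)
    (X Y : Π u : TangentBundle 𝓘(ℝ, E) M, TangentSpace 𝓘(ℝ, E).tangent u)
    (u : TangentBundle 𝓘(ℝ, E) M) : PiTM E M u :=
  D (fun w ↦ rho w (Y w)) u (X u) - D (fun w ↦ rho w (X w)) u (Y u)
    - rho u (VectorField.mlieBracket 𝓘(ℝ, E).tangent X Y u)

/-- The (h)h-torsion `Q(X, Y) = 𝐓(βX, βY)`. -/
def hhTorsion (D : PreConnection E M) (X Y : Π u : TangentBundle 𝓘(ℝ, E) M, PiTM E M u) :
    Π u : TangentBundle 𝓘(ℝ, E) M, PiTM E M u :=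
  torsion D (fun w ↦ beta D w (X w)) (fun w ↦ beta D w (Y w))

/-- The (h)hv-torsion `T(X, Y) = 𝐓(γX, βY)`. -/
def hhvTorsion (D : PreConnection E M) (X Y : Π u : TangentBundle 𝓘(ℝ, E) M, PiTM E M u) :
    Π u : TangentBundle 𝓘(ℝ, E) M, PiTM E M u :=
  torsion D (fun w ↦ gamma w (X w)) (fun w ↦ beta D w (Y w))

/-- `D` is the Cartan connection of `(M, L)`: the regular connection which is metric, has vanishing
(h)h-torsion, and whose (h)hv-torsion satisfies `g(T(X, Y), Z) = g(T(X, Z), Y)`. -/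
structure IsCartanConnection (L : TangentBundle 𝓘(ℝ, E) M → ℝ) (D : PreConnection E M) :
    Prop where
  isConnection : IsConnection D
  isRegular : IsRegular D
  isMetric : ∀ Y Z : Π u : TangentBundle 𝓘(ℝ, E) M, PiTM E M u,
    IsSmoothPiField Y → IsSmoothPiField Z →
    ∀ u ∈ slit E M, ∀ X : TangentSpace 𝓘(ℝ, E).tangent u,
      mvfderiv 𝓘(ℝ, E).tangent (fun w ↦ metric L w (Y w) (Z w)) u X
        = metric L u (D Y u X) (Z u) + metric L u (Y u) (D Z u X)
  hhTorsion_eq_zero : ∀ X Y : Π u : TangentBundle 𝓘(ℝ, E) M, PiTM E M u,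
    IsSmoothPiField X → IsSmoothPiField Y → ∀ u ∈ slit E M, hhTorsion D X Y u = 0
  hhvTorsion_symm : ∀ X Y Z : Π u : TangentBundle 𝓘(ℝ, E) M, PiTM E M u,
    IsSmoothPiField X → IsSmoothPiField Y → IsSmoothPiField Z → ∀ u ∈ slit E M,
      metric L u (hhvTorsion D X Y u) (Z u) = metric L u (hhvTorsion D X Z u) (Y u)

/-- The `π`-vector field `ζ` is concurrent with respect to (the Cartan connection) `D`:
`D_X ζ = - ρX`. -/
structure IsConcurrent (D : PreConnection E M) (ζ : Π u : TangentBundle 𝓘(ℝ, E) M, PiTM E M u) :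
    Prop where
  smooth : IsSmoothPiField ζ
  cov_eq : ∀ u ∈ slit E M, ∀ X : TangentSpace 𝓘(ℝ, E).tangent u, D ζ u X = -rho u X

/-- `U(v, Y) = g(v, Y) / (1 + p²) ζ - g(v, η) / (1 + p²) D_{γζ} Y` at `u`, with `p² = g(ζ, ζ)`. -/
def horizontalChange (L : TangentBundle 𝓘(ℝ, E) M → ℝ) (D : PreConnection E M)
    (ζ : Π u : TangentBundle 𝓘(ℝ, E) M, PiTM E M u) (u : TangentBundle 𝓘(ℝ, E) M)
    (v : PiTM E M u) (Y : Π u : TangentBundle 𝓘(ℝ, E) M, PiTM E M u) : PiTM E M u :=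
  (metric L u v (Y u) / (1 + metric L u (ζ u) (ζ u))) • ζ u
    - (metric L u v (eta u) / (1 + metric L u (ζ u) (ζ u))) • D Y u (gamma u (ζ u))

end Finsler

end

/-!
Since `ζ` is concurrent, `g(ζ, ·)` is the differential of `-p² / 2`, pulled back to `TM` by `ρ`, and
`-p² / 2` is constant along the fibres. The symmetry of second derivatives shows that the components
of `g(ζ, ·)` in coordinates of `M` are constant along the fibres too. Hence `ζ` annihilates the
Cartan torsion, `B` is linear on the fibres, and `L'² = L² + B²` has metric `g' = g + g(ζ, ·)²`.

Being determined by the vertical derivatives of the metrics, the vertical parts of the two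
connections agree. The deviation of `D'` from the asserted formula is then a tensor `a(v, w)` which
is skew for `g'` in its last two arguments, because both connections are metric, and whose torsion
is determined by `a(·, η)` through the Cartan torsion. As the latter is symmetric and vanishes on
`η`, this forces first `a(·, η) = 0` and then, as in the uniqueness of the Levi-Civita connection,
`a = 0`.
-/

section Derivatives

variable {𝕜 : Type*} [NontriviallyNormedField 𝕜] {V W G : Type*}
  [NormedAddCommGroup V] [NormedSpace 𝕜 V] [NormedAddCommGroup W] [NormedSpace 𝕜 W]
  [NormedAddCommGroup G] [NormedSpace 𝕜 G]

lemma fderiv_clm_apply_const {c : V → W →L[𝕜] G} {x : V} (hc : DifferentiableAt 𝕜 c x)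
    (v : V) (w : W) : fderiv 𝕜 (fun y ↦ c y w) x v = fderiv 𝕜 c x v w := by
  simp [fderiv_clm_apply hc (differentiableAt_const w)]

lemma differentiableAt_fderiv_of_contDiffAt {f : V → G} {x : V} (hf : ContDiffAt 𝕜 2 f x) :
    DifferentiableAt 𝕜 (fderiv 𝕜 f) x :=
  (hf.fderiv_right (m := 1) (by norm_num)).differentiableAt one_ne_zero

lemma fderiv_fderiv_comp_affine {f : W → G} {A : V → W} {ℓ : V →L[𝕜] W} {y : V}
    (hA : ∀ z, HasFDerivAt A ℓ z) (hf : ContDiffAt 𝕜 2 f (A y)) (a b : V) :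
    fderiv 𝕜 (fderiv 𝕜 (f ∘ A)) y a b = fderiv 𝕜 (fderiv 𝕜 f) (A y) (ℓ a) (ℓ b) := by
  have hfA : fderiv 𝕜 (f ∘ A) =ᶠ[𝓝 y] fun z ↦ (fderiv 𝕜 f (A z)).comp ℓ := by
    filter_upwards [(hA y).continuousAt.eventually (hf.eventually (by simp))] with z hz
    exact ((hz.differentiableAt two_ne_zero).hasFDerivAt.comp z (hA z)).fderiv
  have hdf : HasFDerivAt (fun z ↦ fderiv 𝕜 f (A z)) _ y :=
    (differentiableAt_fderiv_of_contDiffAt hf).hasFDerivAt.comp y (hA y)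
  rw [hfA.fderiv_eq, (hdf.clm_comp (hasFDerivAt_const ℓ y)).fderiv]
  simp

lemma fderiv_smul_of_homogeneous {f : V → G} {n : ℕ} {t : 𝕜} (ht : t ≠ 0)
    (hf : ∀ y, f (t • y) = t ^ (n + 1) • f y) (y : V) :
    fderiv 𝕜 f (t • y) = t ^ n • fderiv 𝕜 f y := by
  have h : t • fderiv 𝕜 f (t • y) = t ^ (n + 1) • fderiv 𝕜 f y := by
    rw [← fderiv_comp_smul, funext hf]
    exact congrFun (fderiv_const_smul_field _) y
  rw [pow_succ', mul_smul] at h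
  exact smul_right_injective _ ht h

lemma map_fderiv_eq_zero_of_eventually_eq {f : V → W} {x : V} (ℓ : W →L[𝕜] G) {c : G}
    (hf : ∀ᶠ y in 𝓝 x, ℓ (f y) = c) (v : V) : ℓ (fderiv 𝕜 f x v) = 0 := by
  by_cases hd : DifferentiableAt 𝕜 f x
  · have hconst : HasFDerivAt (fun y ↦ ℓ (f y)) (0 : V →L[𝕜] G) x :=
      (hasFDerivAt_const c x).congr_of_eventuallyEq hf
    exact DFunLike.congr_fun ((ℓ.hasFDerivAt.comp x hd.hasFDerivAt).unique hconst) v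
  · rw [fderiv_zero_of_not_differentiableAt hd, zero_apply, map_zero]

lemma map_lieBracket_eq_zero_of_eventually_eq {X Y : V → V} {x : V} (ℓ : V →L[𝕜] G) {a b : G}
    (hX : ∀ᶠ y in 𝓝 x, ℓ (X y) = a) (hY : ∀ᶠ y in 𝓝 x, ℓ (Y y) = b) :
    ℓ (VectorField.lieBracket 𝕜 X Y x) = 0 := by
  rw [VectorField.lieBracket, map_sub, map_fderiv_eq_zero_of_eventually_eq ℓ hY,
    map_fderiv_eq_zero_of_eventually_eq ℓ hX, sub_zero]

variable [IsRCLikeNormedField 𝕜]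

lemma fderiv_fderiv_apply_eq_zero {f : V → G} {x b : V} (hf : ContDiffAt 𝕜 2 f x)
    (hb : ∀ᶠ y in 𝓝 x, fderiv 𝕜 f y b = 0) (v : V) :
    fderiv 𝕜 (fun y ↦ fderiv 𝕜 f y v) x b = 0 := by
  have hb' : (fun y ↦ fderiv 𝕜 f y b) =ᶠ[𝓝 x] fun _ ↦ 0 := hb
  rw [fderiv_clm_apply_const (differentiableAt_fderiv_of_contDiffAt hf),
    (hf.isSymmSndFDerivAt (by simp)).eq b v,
    ← fderiv_clm_apply_const (differentiableAt_fderiv_of_contDiffAt hf), hb'.fderiv_eq]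
  simp

end Derivatives

section RealDerivatives

variable {V G : Type*} [NormedAddCommGroup V] [NormedSpace ℝ V] [NormedAddCommGroup G]
  [NormedSpace ℝ G]

lemma fderiv_apply_self_of_smul_eq {f : V → G} {y : V} (hf : DifferentiableAt ℝ f y)
    (hsmul : ∀ t : ℝ, 0 < t → f (t • y) = f y) : fderiv ℝ f y y = 0 := by
  have hray : HasDerivAt (fun t : ℝ ↦ t • y) y 1 := by
    simpa using (hasDerivAt_id (1 : ℝ)).smul_const y
  have hconst : (fun t : ℝ ↦ f (t • y)) =ᶠ[𝓝 1] fun _ ↦ f y := by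
    filter_upwards [lt_mem_nhds (zero_lt_one' ℝ)] with t ht using hsmul t ht
  have hcomp : HasDerivAt (fun t : ℝ ↦ f (t • y)) (fderiv ℝ f y y) 1 :=
    HasFDerivAt.comp_hasDerivAt (1 : ℝ) (by simpa using hf.hasFDerivAt) hray
  exact hcomp.unique ((hasDerivAt_const 1 (f y)).congr_of_eventuallyEq hconst)

lemma fderiv_fderiv_add_half_sq {h β : V → ℝ} {y : V} (hh : ContDiffAt ℝ 2 h y)
    (hβ : ContDiffAt ℝ 2 β y) (v w : V) :
    fderiv ℝ (fderiv ℝ fun z ↦ h z + 1 / 2 * β z ^ 2) y v w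
      = fderiv ℝ (fderiv ℝ h) y v w + β y * fderiv ℝ (fderiv ℝ β) y v w
        + fderiv ℝ β y v * fderiv ℝ β y w := by
  have hfst : fderiv ℝ (fun z ↦ h z + 1 / 2 * β z ^ 2)
      =ᶠ[𝓝 y] fun z ↦ fderiv ℝ h z + β z • fderiv ℝ β z := by
    filter_upwards [hh.eventually (by simp), hβ.eventually (by simp)] with z hhz hβz
    have hsum : HasFDerivAt (fun z ↦ h z + 1 / 2 * β z ^ 2) _ z :=
      (hhz.differentiableAt two_ne_zero).hasFDerivAt.add
        (((hβz.differentiableAt two_ne_zero).hasFDerivAt.pow 2).const_mul (1 / 2))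
    rw [hsum.fderiv]
    ext a
    simp
    ring
  have hsnd : HasFDerivAt (fun z ↦ fderiv ℝ h z + β z • fderiv ℝ β z) _ y :=
    (differentiableAt_fderiv_of_contDiffAt hh).hasFDerivAt.add
      ((hβ.differentiableAt two_ne_zero).hasFDerivAt.smul
        (differentiableAt_fderiv_of_contDiffAt hβ).hasFDerivAt)
  rw [hfst.fderiv_eq, hsnd.fderiv]
  simp [add_assoc]

end RealDerivatives

section Charts

variable {𝕜 : Type*} [NontriviallyNormedField 𝕜] {V : Type*} [NormedAddCommGroup V]
  [NormedSpace 𝕜 V] {H : Type*} [TopologicalSpace H] {I : ModelWithCorners 𝕜 V H} [I.Boundaryless]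
  {N : Type*} [TopologicalSpace N] [ChartedSpace H N]
  {G : Type*} [NormedAddCommGroup G] [NormedSpace 𝕜 G]

lemma contDiffAt_comp_extChartAt_symm {n : ℕ∞ω} [IsManifold I n N] {f : N → G} {x y : N}
    (hy : y ∈ (extChartAt I x).source) (hf : ContMDiffAt I 𝓘(𝕜, G) n f y) :
    ContDiffAt 𝕜 n (f ∘ (extChartAt I x).symm) (extChartAt I x y) := by
  have hsymm : ContMDiffAt 𝓘(𝕜, V) I n (extChartAt I x).symm (extChartAt I x y) :=
    (contMDiffOn_extChartAt_symm x).contMDiffAt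
      (extChartAt_target_mem_nhds' ((extChartAt I x).map_source hy))
  have hf' : ContMDiffAt I 𝓘(𝕜, G) n f ((extChartAt I x).symm (extChartAt I x y)) := by
    rwa [(extChartAt I x).left_inv hy]
  exact (hf'.comp _ hsymm).contDiffAt

variable [IsManifold I 1 N]

lemma mvfderiv_eq_fderiv_comp_extChartAt_symm {f : N → G} {x y : N}
    (hy : y ∈ (extChartAt I x).source) (hf : MDifferentiableAt I 𝓘(𝕜, G) f y)
    (X : TangentSpace I y) :
    mvfderiv I f y X = fderiv 𝕜 (f ∘ (extChartAt I x).symm) (extChartAt I x y)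
      (mfderiv I 𝓘(𝕜, V) (extChartAt I x) y X) := by
  have hp : extChartAt I x y ∈ (extChartAt I x).target := (extChartAt I x).map_source hy
  have hsymm : MDifferentiableAt 𝓘(𝕜, V) I (extChartAt I x).symm (extChartAt I x y) :=
    (contMDiffOn_extChartAt_symm (n := 1) x).contMDiffAt (extChartAt_target_mem_nhds' hp)
      |>.mdifferentiableAt one_ne_zero
  have hf' : MDifferentiableAt I 𝓘(𝕜, G) f ((extChartAt I x).symm (extChartAt I x y)) := by
    rwa [(extChartAt I x).left_inv hy]
  have hchart : HasMFDerivAt I 𝓘(𝕜, V) (extChartAt I x) y _ :=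
    (mdifferentiableAt_extChartAt (by rwa [← extChartAt_source I x])).hasMFDerivAt
  have hcomp := (hf'.comp _ hsymm).differentiableAt.hasFDerivAt.hasMFDerivAt.comp y hchart
  have hf_eq : f =ᶠ[𝓝 y] (f ∘ (extChartAt I x).symm) ∘ extChartAt I x := by
    filter_upwards [(isOpen_extChartAt_source x).mem_nhds hy] with z hz
    exact congrArg f ((extChartAt I x).left_inv hz).symm
  exact DFunLike.congr_fun (hcomp.congr_of_eventuallyEq hf_eq).mfderiv X

lemma mfderiv_extChartAt_mlieBracket (X Y : Π x : N, TangentSpace I x) (x : N) :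
    mfderiv I 𝓘(𝕜, V) (extChartAt I x) x (VectorField.mlieBracket I X Y x)
      = VectorField.lieBracket 𝕜
        (fun p ↦ mfderiv I 𝓘(𝕜, V) (extChartAt I x) ((extChartAt I x).symm p)
          (X ((extChartAt I x).symm p)))
        (fun p ↦ mfderiv I 𝓘(𝕜, V) (extChartAt I x) ((extChartAt I x).symm p)
          (Y ((extChartAt I x).symm p))) (extChartAt I x x) := by
  have hpull (Z : Π x : N, TangentSpace I x) :
      VectorField.mpullbackWithin 𝓘(𝕜, V) I (extChartAt I x).symm Z (Set.range I)
        =ᶠ[𝓝 (extChartAt I x x)] fun p ↦ mfderiv I 𝓘(𝕜, V) (extChartAt I x)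
          ((extChartAt I x).symm p) (Z ((extChartAt I x).symm p)) := by
    filter_upwards [extChartAt_target_mem_nhds x] with p hp
    rw [VectorField.mpullbackWithin_apply, ContinuousLinearMap.inverse_eq
      (mfderivWithin_extChartAt_symm_comp_mfderiv_extChartAt hp)
      (mfderiv_extChartAt_comp_mfderivWithin_extChartAt_symm hp)]
    rfl
  have huniv : (extChartAt I x).symm ⁻¹' Set.univ ∩ Set.range I = Set.univ := by
    rw [Set.preimage_univ, Set.univ_inter, I.range_eq_univ]
  exact ((isInvertible_mfderiv_extChartAt (mem_extChartAt_source x)).self_apply_inverse _).trans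
    ((congrArg (fun s ↦ VectorField.lieBracketWithin 𝕜 _ _ s _) huniv).trans
      ((congrFun VectorField.lieBracketWithin_univ _).trans
        ((hpull X).lieBracket_vectorField_eq (hpull Y))))

end Charts

lemma mvfderiv_eq_of_eventuallyEq {𝕜 : Type*} [NontriviallyNormedField 𝕜] {V : Type*}
    [NormedAddCommGroup V] [NormedSpace 𝕜 V] {H : Type*} [TopologicalSpace H]
    {I : ModelWithCorners 𝕜 V H} {N : Type*} [TopologicalSpace N] [ChartedSpace H N]
    {G : Type*} [NormedAddCommGroup G] [NormedSpace 𝕜 G] {f g : N → G} {x : N}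
    (h : f =ᶠ[𝓝 x] g) : mvfderiv I f x = mvfderiv I g x := by
  rw [mvfderiv, mvfderiv, h.mfderiv_eq]
  rfl

section SkewTensors

variable {K V : Type*} [Field K] [NeZero (2 : K)] [AddCommGroup V] [Module K V]
  {g : V →ₗ[K] V →ₗ[K] K} {a : V → V → V}

lemma eq_zero_of_skew_of_symm (hg : g.SeparatingLeft)
    (hskew : ∀ v w z, g (a v w) z = -g (a v z) w) (hsymm : ∀ v w, a v w = a w v) (v w : V) :
    a v w = 0 := by
  refine hg _ fun z ↦ ?_
  have hneg : g (a v w) z = -g (a v w) z :=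
    calc g (a v w) z = -g (a v z) w := hskew v w z
      _ = g (a z w) v := by rw [hsymm v z, hskew z v w, neg_neg]
      _ = -g (a v w) z := by rw [hsymm z w, hskew w z v, hsymm w v]
  have htwo : (2 : K) * g (a v w) z = 0 := by linear_combination hneg
  exact (mul_eq_zero.1 htwo).resolve_left two_ne_zero

-- Pairing the torsion identity with `η` shows that `a` vanishes when one argument is `η`; the
-- torsion of `a` is then zero.
lemma eq_zero_of_skew_of_torsion (hg : g.SeparatingLeft) {T : V → V → V} {η : V}
    (hT : ∀ v w z, g (T v w) z = g (T v z) w) (hT_zero : ∀ w, T 0 w = 0) (hT_eta : ∀ v, T v η = 0)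
    (hskew : ∀ v w z, g (a v w) z = -g (a v z) w)
    (htorsion : ∀ v w, a v w - a w v = T (a v η) w - T (a w η) v) (v w : V) : a v w = 0 := by
  have hT_apply_eta (v w : V) : g (T v w) η = 0 := by
    rw [hT, hT_eta, map_zero, LinearMap.zero_apply]
  have hsymm_apply_eta (v w : V) : g (a v w) η = g (a w v) η := by
    rw [← sub_eq_zero, ← LinearMap.sub_apply, ← map_sub, htorsion, map_sub,
      LinearMap.sub_apply, hT_apply_eta, hT_apply_eta, sub_zero]
  have heta_eta : a η η = 0 := hg _ fun v ↦ by
    have htwo : (2 : K) * g (a η η) v = 0 := by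
      linear_combination 2 * hskew η η v - 2 * hsymm_apply_eta η v - hskew v η η
    exact (mul_eq_zero.1 htwo).resolve_left two_ne_zero
  have hsymm_eta (v : V) : a v η = a η v := by
    rw [← sub_eq_zero, htorsion, hT_eta, heta_eta, hT_zero, sub_zero]
  have heta (w : V) : a η w = 0 := hg _ fun z ↦ by
    have htwo : (2 : K) * g (a η w) z = 0 :=
      calc (2 : K) * g (a η w) z = g (a η w) z - g (a η z) w := by rw [hskew η z w]; ring
        _ = g (a z w) η - g (a w z) η := by
          rw [hskew z w η, hskew w z η, hsymm_eta, hsymm_eta]; ring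
        _ = 0 := by rw [hsymm_apply_eta, sub_self]
    exact (mul_eq_zero.1 htwo).resolve_left two_ne_zero
  refine eq_zero_of_skew_of_symm hg hskew (fun v w ↦ sub_eq_zero.1 ?_) v w
  rw [htorsion, hsymm_eta, hsymm_eta, heta, heta, hT_zero, hT_zero, sub_zero]

end SkewTensors

namespace Finsler

variable {E : Type*} [NormedAddCommGroup E] [NormedSpace ℝ E]
  {M : Type*} [TopologicalSpace M] [ChartedSpace E M]

/-- The domain of the chart of `TM` at `u`. -/
def chartDom (u : TangentBundle 𝓘(ℝ, E) M) : Set (TangentBundle 𝓘(ℝ, E) M) :=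
  {w | w.proj ∈ (chartAt E u.proj).source}

lemma mem_chartDom_self (u : TangentBundle 𝓘(ℝ, E) M) : u ∈ chartDom u :=
  mem_chart_source E u.proj

variable [IsManifold 𝓘(ℝ, E) ∞ M]

/-- The coordinates, in the chart at `π u`, of an element of the pullback bundle over `w`; zero if
`w` is not in the domain of this chart. -/
noncomputable def toModel (u w : TangentBundle 𝓘(ℝ, E) M) : PiTM E M w →L[ℝ] E :=
  (trivializationAt E (TangentSpace 𝓘(ℝ, E) : M → Type _) u.proj).continuousLinearMapAt ℝ w.proj

/-- The element of the pullback bundle over `w` with given coordinates in the chart at `π u`; zero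
if `w` is not in the domain of this chart. -/
noncomputable def ofModel (u w : TangentBundle 𝓘(ℝ, E) M) : E →L[ℝ] PiTM E M w :=
  (trivializationAt E (TangentSpace 𝓘(ℝ, E) : M → Type _) u.proj).symmL ℝ w.proj

/-- The identification of the model space with the fibre of the pullback bundle over `w`, used
where a vector of the model space has to be read as a vector of that fibre. -/
def fibreId (w : TangentBundle 𝓘(ℝ, E) M) : E →L[ℝ] PiTM E M w :=
  ContinuousLinearMap.id ℝ E

/-- The derivative at `w` of the chart of `TM` at `u`. -/
noncomputable def chartDeriv (u w : TangentBundle 𝓘(ℝ, E) M) :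
    TangentSpace 𝓘(ℝ, E).tangent w →L[ℝ] E × E :=
  mfderiv 𝓘(ℝ, E).tangent 𝓘(ℝ, E × E) (extChartAt 𝓘(ℝ, E).tangent u) w

section Coordinates

variable {u w : TangentBundle 𝓘(ℝ, E) M}

lemma toModel_ofModel (hw : w ∈ chartDom u) (v : E) : toModel u w (ofModel u w v) = v :=
  (trivializationAt E (TangentSpace 𝓘(ℝ, E) : M → Type _) u.proj).continuousLinearMapAt_symmL hw v

lemma ofModel_toModel (hw : w ∈ chartDom u) (v : PiTM E M w) :
    ofModel u w (toModel u w v) = v :=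
  (trivializationAt E (TangentSpace 𝓘(ℝ, E) : M → Type _) u.proj).symmL_continuousLinearMapAt hw v

lemma toModel_apply (hw : w ∈ chartDom u) (v : PiTM E M w) :
    toModel u w v
      = (trivializationAt E (TangentSpace 𝓘(ℝ, E) : M → Type _) u.proj ⟨w.proj, v⟩).2 :=
  congrFun ((trivializationAt E (TangentSpace 𝓘(ℝ, E) : M → Type _) u.proj).coe_linearMapAt_of_mem
    (R := ℝ) hw) v

lemma toModel_eq_mfderiv (hw : w ∈ chartDom u) :
    toModel u w = mfderiv 𝓘(ℝ, E) 𝓘(ℝ, E) (extChartAt 𝓘(ℝ, E) u.proj) w.proj :=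
  TangentBundle.continuousLinearMapAt_trivializationAt hw

lemma toModel_fibreId (u : TangentBundle 𝓘(ℝ, E) M) (y v : E) :
    toModel u (fibreIncl u.proj y) (fibreId (fibreIncl u.proj y) v) = v :=
  (toModel_apply (u := u) (w := fibreIncl u.proj y) (mem_chartDom_self u) _).trans
    ((tangentBundleCore 𝓘(ℝ, E) M).coordChange_self _ _ (mem_chart_source E u.proj) v)

lemma fibreId_toModel (u : TangentBundle 𝓘(ℝ, E) M) (v : PiTM E M u) :
    fibreId u (toModel u u v) = v :=
  toModel_fibreId u u.2 v

lemma ofModel_fibreId (u : TangentBundle 𝓘(ℝ, E) M) (y v : E) :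
    ofModel u (fibreIncl u.proj y) v = fibreId (fibreIncl u.proj y) v := by
  rw [← ofModel_toModel (u := u) (w := fibreIncl u.proj y) (mem_chartDom_self u)
    (fibreId (fibreIncl u.proj y) v), toModel_fibreId]

lemma toModel_eta_self (u : TangentBundle 𝓘(ℝ, E) M) : toModel u u (eta u) = fibreCoord u :=
  toModel_fibreId u u.2 u.2

lemma isOpen_chartDom (u : TangentBundle 𝓘(ℝ, E) M) : IsOpen (chartDom u) :=
  (chartAt E u.proj).open_source.preimage
    (FiberBundle.continuous_proj E (TangentSpace 𝓘(ℝ, E) : M → Type _))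

lemma chartDom_mem_nhds (u : TangentBundle 𝓘(ℝ, E) M) : chartDom u ∈ 𝓝 u :=
  (isOpen_chartDom u).mem_nhds (mem_chartDom_self u)

lemma extChartAt_tangent_source (u : TangentBundle 𝓘(ℝ, E) M) :
    (extChartAt 𝓘(ℝ, E).tangent u).source = chartDom u := by
  ext w
  rw [extChartAt_source]
  exact TangentBundle.mem_chart_source_iff (I := 𝓘(ℝ, E)) w u

lemma extChartAt_tangent_apply (hw : w ∈ chartDom u) :
    extChartAt 𝓘(ℝ, E).tangent u w = (extChartAt 𝓘(ℝ, E) u.proj w.proj, toModel u w (eta w)) :=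
  Prod.ext rfl (toModel_apply hw (eta w)).symm

lemma contMDiffAt_extChartAt_tangent (hw : w ∈ chartDom u) :
    ContMDiffAt 𝓘(ℝ, E).tangent 𝓘(ℝ, E × E) ∞ (extChartAt 𝓘(ℝ, E).tangent u) w :=
  contMDiffAt_extChartAt' (I := 𝓘(ℝ, E).tangent) (x := u)
    ((TangentBundle.mem_chart_source_iff (I := 𝓘(ℝ, E)) w u).2 hw)

lemma hasMFDerivAt_extChartAt_tangent (hw : w ∈ chartDom u) :
    HasMFDerivAt 𝓘(ℝ, E).tangent 𝓘(ℝ, E × E) (extChartAt 𝓘(ℝ, E).tangent u) w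
      (chartDeriv u w) :=
  ((contMDiffAt_extChartAt_tangent hw).mdifferentiableAt (by simp)).hasMFDerivAt

lemma chartDeriv_isInvertible (hw : w ∈ chartDom u) : (chartDeriv u w).IsInvertible :=
  isInvertible_mfderiv_extChartAt (I := 𝓘(ℝ, E).tangent) (by rwa [extChartAt_tangent_source])

lemma chartDeriv_fst (hw : w ∈ chartDom u) (X : TangentSpace 𝓘(ℝ, E).tangent w) :
    (chartDeriv u w X).1 = toModel u w (rho w X) := by
  have hfst : HasMFDerivAt 𝓘(ℝ, E × E) 𝓘(ℝ, E) (Prod.fst : E × E → E)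
      (extChartAt 𝓘(ℝ, E).tangent u w) (ContinuousLinearMap.fst ℝ E E) :=
    (ContinuousLinearMap.fst ℝ E E).hasMFDerivAt
  have hproj : HasMFDerivAt 𝓘(ℝ, E).tangent 𝓘(ℝ, E) (projTM E M) w (rho w) :=
    ((projTM E M).contMDiff.mdifferentiableAt (by simp)).hasMFDerivAt
  have hchart : HasMFDerivAt 𝓘(ℝ, E) 𝓘(ℝ, E) (extChartAt 𝓘(ℝ, E) u.proj) (projTM E M w)
      (toModel u w) := by
    rw [toModel_eq_mfderiv hw]
    exact (mdifferentiableAt_extChartAt hw).hasMFDerivAt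
  exact DFunLike.congr_fun (hasMFDerivAt_unique
    (hfst.comp w (hasMFDerivAt_extChartAt_tangent hw)) (hchart.comp w hproj)) X

lemma contMDiff_fibreIncl (x : M) :
    ContMDiff 𝓘(ℝ, E) 𝓘(ℝ, E).tangent ∞ (fibreIncl x : E → TangentBundle 𝓘(ℝ, E) M) := by
  intro y
  rw [contMDiffAt_totalSpace]
  refine ⟨contMDiffAt_const, contMDiffAt_id.congr_of_eventuallyEq (.of_forall fun w ↦ ?_)⟩
  exact (tangentBundleCore 𝓘(ℝ, E) M).coordChange_self _ _ (mem_chart_source E x) w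

lemma hasMFDerivAt_fibreIncl (u : TangentBundle 𝓘(ℝ, E) M) :
    HasMFDerivAt 𝓘(ℝ, E) 𝓘(ℝ, E).tangent (fibreIncl u.proj) (fibreCoord u) (gamma u) :=
  ((contMDiff_fibreIncl u.proj).mdifferentiableAt (by simp)).hasMFDerivAt

lemma hasFDerivAt_extChartAt_comp_fibreIncl (hw : w ∈ chartDom u) (y : E) :
    HasFDerivAt (extChartAt 𝓘(ℝ, E).tangent u ∘ fibreIncl w.proj)
      (ContinuousLinearMap.prod 0 (toModel u w ∘L fibreId w) : E →L[ℝ] E × E) y := by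
  have hchart : extChartAt 𝓘(ℝ, E).tangent u ∘ fibreIncl w.proj = fun y : E ↦
      (extChartAt 𝓘(ℝ, E) u.proj w.proj, (toModel u w ∘L fibreId w) y) :=
    funext fun y ↦ extChartAt_tangent_apply (u := u) (w := fibreIncl w.proj y) hw
  rw [hchart]
  exact (hasFDerivAt_const _ _).prodMk (toModel u w ∘L fibreId w).hasFDerivAt

lemma chartDeriv_gamma (hw : w ∈ chartDom u) (v : PiTM E M w) :
    chartDeriv u w (gamma w v) = (0, toModel u w v) := by
  have hcomp := HasMFDerivAt.comp (fibreCoord w) (f := fibreIncl w.proj)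
    (hasMFDerivAt_extChartAt_tangent hw) (hasMFDerivAt_fibreIncl w)
  exact DFunLike.congr_fun (hasMFDerivAt_unique hcomp
    (hasFDerivAt_extChartAt_comp_fibreIncl hw _).hasMFDerivAt) v

lemma rho_gamma (u : TangentBundle 𝓘(ℝ, E) M) (v : PiTM E M u) : rho u (gamma u v) = 0 := by
  rw [← ofModel_toModel (mem_chartDom_self u) (rho u (gamma u v)),
    ← chartDeriv_fst (mem_chartDom_self u), chartDeriv_gamma (mem_chartDom_self u), map_zero]

lemma rho_surjective (u : TangentBundle 𝓘(ℝ, E) M) : Function.Surjective (rho u) := by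
  intro v
  obtain ⟨X, hX⟩ := (chartDeriv_isInvertible (mem_chartDom_self u)).bijective.2 (toModel u u v, 0)
  refine ⟨X, ?_⟩
  rw [← ofModel_toModel (mem_chartDom_self u) (rho u X), ← chartDeriv_fst (mem_chartDom_self u),
    hX, ofModel_toModel (mem_chartDom_self u)]

lemma exists_gamma_eq_of_rho_eq_zero {X : TangentSpace 𝓘(ℝ, E).tangent u} (hX : rho u X = 0) :
    ∃ v, gamma u v = X := by
  refine ⟨ofModel u u (chartDeriv u u X).2,
    (chartDeriv_isInvertible (mem_chartDom_self u)).bijective.1 ?_⟩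
  rw [chartDeriv_gamma (mem_chartDom_self u), toModel_ofModel (mem_chartDom_self u)]
  refine Prod.ext ?_ rfl
  rw [chartDeriv_fst (mem_chartDom_self u), hX, map_zero]

lemma eventually_extChartAt_tangent_symm {p : TangentBundle 𝓘(ℝ, E) M → Prop}
    (h : ∀ᶠ q in 𝓝 u, p q) :
    ∀ᶠ z in 𝓝 (extChartAt 𝓘(ℝ, E).tangent u u), p ((extChartAt 𝓘(ℝ, E).tangent u).symm z) := by
  refine (continuousAt_extChartAt_symm (I := 𝓘(ℝ, E).tangent) u).eventually ?_
  rwa [extChartAt_to_inv]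

lemma rho_mlieBracket_eq_zero {V W : Π u : TangentBundle 𝓘(ℝ, E) M, TangentSpace 𝓘(ℝ, E).tangent u}
    {v w : E} (hV : ∀ᶠ q in 𝓝 u, rho q (V q) = ofModel u q v)
    (hW : ∀ᶠ q in 𝓝 u, rho q (W q) = ofModel u q w) :
    rho u (VectorField.mlieBracket 𝓘(ℝ, E).tangent V W u) = 0 := by
  have hfst {V : Π u : TangentBundle 𝓘(ℝ, E) M, TangentSpace 𝓘(ℝ, E).tangent u} {v : E}
      (hV : ∀ᶠ q in 𝓝 u, rho q (V q) = ofModel u q v) :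
      ∀ᶠ q in 𝓝 u, (chartDeriv u q (V q)).1 = v := by
    filter_upwards [hV, chartDom_mem_nhds u] with q hq hqu
    rw [chartDeriv_fst hqu, hq, toModel_ofModel hqu]
  have hbracket : (chartDeriv u u (VectorField.mlieBracket 𝓘(ℝ, E).tangent V W u)).1 = 0 :=
    (congrArg Prod.fst (mfderiv_extChartAt_mlieBracket V W u)).trans
      (map_lieBracket_eq_zero_of_eventually_eq (ContinuousLinearMap.fst ℝ E E)
        (eventually_extChartAt_tangent_symm (hfst hV))
        (eventually_extChartAt_tangent_symm (hfst hW)))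
  rw [← ofModel_toModel (mem_chartDom_self u) (rho u _), ← chartDeriv_fst (mem_chartDom_self u),
    hbracket, map_zero]

end Coordinates

section SmoothSections

variable {u w : TangentBundle 𝓘(ℝ, E) M} {Y : Π u : TangentBundle 𝓘(ℝ, E) M, PiTM E M u}

lemma isOpen_slit : IsOpen (slit E M) := by
  rw [isOpen_iff_mem_nhds]
  intro u hu
  have hcont : ContinuousAt (fun w ↦ (extChartAt 𝓘(ℝ, E).tangent u w).2) u :=
    (continuousAt_extChartAt (I := 𝓘(ℝ, E).tangent) u).snd
  have hne : (extChartAt 𝓘(ℝ, E).tangent u u).2 ≠ 0 := by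
    rw [extChartAt_tangent_apply (mem_chartDom_self u), toModel_eta_self]
    exact hu
  filter_upwards [hcont.eventually_ne hne, chartDom_mem_nhds u] with w hw hwu hw_zero
  rw [extChartAt_tangent_apply hwu, show eta w = 0 from hw_zero, map_zero] at hw
  exact hw rfl

lemma contMDiffAt_piField_iff {n : ℕ∞ω} (hn : n ≤ ∞) (hw : w ∈ chartDom u) :
    ContMDiffAt 𝓘(ℝ, E).tangent (𝓘(ℝ, E).tangent.prod 𝓘(ℝ, E)) n
      (fun q ↦ (⟨q, Y q⟩ : TotalSpace E (PiTM E M))) w ↔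
    ContMDiffAt 𝓘(ℝ, E).tangent 𝓘(ℝ, E) n (fun q ↦ toModel u q (Y q)) w := by
  have : ContMDiffVectorBundle n E (PiTM E M) 𝓘(ℝ, E).tangent := ContMDiffVectorBundle.of_le hn
  rw [(trivializationAt E (PiTM E M) u).contMDiffAt_section_iff (x₀ := w) hw]
  refine Filter.EventuallyEq.contMDiffAt_iff ?_
  filter_upwards [(isOpen_chartDom u).mem_nhds hw] with q hq
  exact (toModel_apply hq (Y q)).symm

lemma mdifferentiableAt_piField_iff :
    MDifferentiableAt 𝓘(ℝ, E).tangent (𝓘(ℝ, E).tangent.prod 𝓘(ℝ, E))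
      (fun q ↦ (⟨q, Y q⟩ : TotalSpace E (PiTM E M))) u ↔
    MDifferentiableAt 𝓘(ℝ, E).tangent 𝓘(ℝ, E) (fun q ↦ toModel u q (Y q)) u := by
  rw [mdifferentiableAt_section]
  refine Filter.EventuallyEq.mdifferentiableAt_iff ?_
  filter_upwards [chartDom_mem_nhds u] with q hq
  exact (toModel_apply hq (Y q)).symm

lemma IsSmoothPiField.contMDiffAt (hY : IsSmoothPiField Y) (hw : w ∈ chartDom u)
    (hws : w ∈ slit E M) :
    ContMDiffAt 𝓘(ℝ, E).tangent 𝓘(ℝ, E) ∞ (fun q ↦ toModel u q (Y q)) w :=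
  (contMDiffAt_piField_iff le_rfl hw).1 ((hY w hws).contMDiffAt (isOpen_slit.mem_nhds hws))

lemma IsSmoothPiField.mdifferentiableAt (hY : IsSmoothPiField Y) (hu : u ∈ slit E M) :
    MDifferentiableAt 𝓘(ℝ, E).tangent (𝓘(ℝ, E).tangent.prod 𝓘(ℝ, E))
      (fun q ↦ (⟨q, Y q⟩ : TotalSpace E (PiTM E M))) u :=
  ((hY u hu).contMDiffAt (isOpen_slit.mem_nhds hu)).mdifferentiableAt (by simp)

lemma contMDiffAt_toModel_eta (hw : w ∈ chartDom u) :
    ContMDiffAt 𝓘(ℝ, E).tangent 𝓘(ℝ, E) ∞ (fun q ↦ toModel u q (eta q)) w := by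
  have hsnd : ContMDiffAt 𝓘(ℝ, E × E) 𝓘(ℝ, E) ∞ (Prod.snd : E × E → E)
      (extChartAt 𝓘(ℝ, E).tangent u w) := contDiff_snd.contMDiff.contMDiffAt
  refine (hsnd.comp w (contMDiffAt_extChartAt_tangent hw)).congr_of_eventuallyEq ?_
  filter_upwards [(isOpen_chartDom u).mem_nhds hw] with q hq
  exact (congrArg Prod.snd (extChartAt_tangent_apply hq)).symm

lemma isSmoothPiField_eta : IsSmoothPiField (eta (E := E) (M := M)) := fun u _ ↦
  ((contMDiffAt_piField_iff le_rfl (mem_chartDom_self u)).2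
    (contMDiffAt_toModel_eta (mem_chartDom_self u))).contMDiffWithinAt

lemma IsSmoothField.mdifferentiableAt_rho
    {X : Π u : TangentBundle 𝓘(ℝ, E) M, TangentSpace 𝓘(ℝ, E).tangent u} (hX : IsSmoothField X)
    (hu : u ∈ slit E M) :
    MDifferentiableAt 𝓘(ℝ, E).tangent (𝓘(ℝ, E).tangent.prod 𝓘(ℝ, E))
      (fun q ↦ (⟨q, rho q (X q)⟩ : TotalSpace E (PiTM E M))) u := by
  have hX_u := ((hX u hu).contMDiffAt (isOpen_slit.mem_nhds hu)).mdifferentiableAt (by simp)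
  rw [mdifferentiableAt_section] at hX_u
  have hchart : MDifferentiableAt 𝓘(ℝ, E).tangent 𝓘(ℝ, E × E)
      (fun q ↦ chartDeriv u q (X q)) u := by
    refine hX_u.congr_of_eventuallyEq ?_
    filter_upwards [chartDom_mem_nhds u] with q hq
    have hq' : q ∈ (chartAt (ModelProd E E) u).source :=
      (TangentBundle.mem_chart_source_iff (I := 𝓘(ℝ, E)) q u).2 hq
    have hderiv := TangentBundle.continuousLinearMapAt_trivializationAt (I := 𝓘(ℝ, E).tangent) hq'
    have htriv := (trivializationAt (E × E)
      (TangentSpace 𝓘(ℝ, E).tangent : TangentBundle 𝓘(ℝ, E) M → Type _) u).coe_linearMapAt_of_mem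
      (R := ℝ) hq'
    exact (DFunLike.congr_fun hderiv (X q)).symm.trans (congrFun htriv (X q))
  rw [mdifferentiableAt_piField_iff]
  refine ((ContinuousLinearMap.fst ℝ E E).differentiableAt.comp_mdifferentiableAt
    hchart).congr_of_eventuallyEq ?_
  filter_upwards [chartDom_mem_nhds u] with q hq
  exact (chartDeriv_fst hq (X q)).symm

end SmoothSections

section CoordinateFields

variable [FiniteDimensional ℝ E]

/-- A global section of the pullback bundle with value `v` at `u`, whose coordinates in the chart
at `π u` are constant near the fibre over `π u`; it extends `v` to a `π`-vector field. -/
noncomputable def coordField (u : TangentBundle 𝓘(ℝ, E) M) (v : PiTM E M u)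
    (w : TangentBundle 𝓘(ℝ, E) M) : PiTM E M w :=
  (Classical.arbitrary (SmoothBumpFunction 𝓘(ℝ, E) u.proj) : M → ℝ) w.proj •
    ofModel u w (toModel u u v)

lemma coordField_eventuallyEq (u : TangentBundle 𝓘(ℝ, E) M) (v : PiTM E M u) (y : E) :
    ∀ᶠ w in 𝓝 (fibreIncl u.proj y), coordField u v w = ofModel u w (toModel u u v) := by
  have hproj : Filter.Tendsto (fun w : TangentBundle 𝓘(ℝ, E) M ↦ w.proj)
      (𝓝 (fibreIncl u.proj y)) (𝓝 u.proj) :=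
    (FiberBundle.continuous_proj E (TangentSpace 𝓘(ℝ, E) : M → Type _)).tendsto (fibreIncl u.proj y)
  filter_upwards [hproj.eventually
    (Classical.arbitrary (SmoothBumpFunction 𝓘(ℝ, E) u.proj)).eventuallyEq_one] with w hw
  rw [coordField, hw, Pi.one_apply, one_smul]

lemma coordField_eventuallyEq_self (u : TangentBundle 𝓘(ℝ, E) M) (v : PiTM E M u) :
    ∀ᶠ w in 𝓝 u, coordField u v w = ofModel u w (toModel u u v) :=
  coordField_eventuallyEq u v u.2

lemma coordField_fibreIncl (u : TangentBundle 𝓘(ℝ, E) M) (v : PiTM E M u) (y : E) :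
    coordField u v (fibreIncl u.proj y) = fibreId (fibreIncl u.proj y) (toModel u u v) :=
  (coordField_eventuallyEq u v y).self_of_nhds.trans (ofModel_fibreId u y _)

@[simp]
lemma coordField_self (u : TangentBundle 𝓘(ℝ, E) M) (v : PiTM E M u) : coordField u v u = v :=
  (coordField_fibreIncl u v u.2).trans (fibreId_toModel u v)

lemma isSmoothPiField_coordField [T2Space M] (u : TangentBundle 𝓘(ℝ, E) M) (v : PiTM E M u) :
    IsSmoothPiField (coordField u v) := by
  set χ := Classical.arbitrary (SmoothBumpFunction 𝓘(ℝ, E) u.proj) with hχ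
  have hχ_smooth : ContMDiff 𝓘(ℝ, E).tangent 𝓘(ℝ, ℝ) ∞ (fun q ↦ χ (projTM E M q)) :=
    χ.contMDiff.comp (projTM E M).contMDiff
  intro w _
  apply ContMDiffAt.contMDiffWithinAt
  by_cases hw : w ∈ chartDom u
  · rw [contMDiffAt_piField_iff le_rfl hw]
    refine (hχ_smooth.smul (contMDiff_const (c := toModel u u v))).contMDiffAt
      |>.congr_of_eventuallyEq ?_
    filter_upwards [(isOpen_chartDom u).mem_nhds hw] with q hq
    rw [coordField, map_smul, toModel_ofModel hq]
    rfl
  · rw [contMDiffAt_piField_iff (u := w) le_rfl (mem_chartDom_self w)]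
    refine (contMDiffAt_const (c := (0 : E))).congr_of_eventuallyEq ?_
    have hw_supp : w.proj ∈ (tsupport χ)ᶜ := fun h ↦ hw (χ.tsupport_subset_chartAt_source h)
    filter_upwards [((isClosed_tsupport χ).isOpen_compl.preimage
      (FiberBundle.continuous_proj E (TangentSpace 𝓘(ℝ, E) : M → Type _))).mem_nhds hw_supp]
      with q hq
    rw [coordField, ← hχ, image_eq_zero_of_notMem_tsupport hq, zero_smul, map_zero]

end CoordinateFields

section Energy

variable {L : TangentBundle 𝓘(ℝ, E) M → ℝ} {u w : TangentBundle 𝓘(ℝ, E) M}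

/-- The energy `½ L²` on the fibre over `x`, identified with the model space; its second derivative
is the metric of `L`. -/
noncomputable def fibreEnergy (L : TangentBundle 𝓘(ℝ, E) M → ℝ) (x : M) (y : E) : ℝ :=
  1 / 2 * L (fibreIncl x y) ^ 2

/-- Twice the Cartan tensor of `L`: the third derivative of the energy along the fibre. -/
noncomputable def cartanTensor (L : TangentBundle 𝓘(ℝ, E) M → ℝ) (u : TangentBundle 𝓘(ℝ, E) M)
    (a b c : PiTM E M u) : ℝ :=
  fderiv ℝ (fderiv ℝ (fderiv ℝ (fibreEnergy L u.proj))) (fibreCoord u) a b c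

/-- The energy `½ L²` read in the chart of `TM` at `u`; it serves to differentiate the metric in all
directions. -/
noncomputable def localEnergy (L : TangentBundle 𝓘(ℝ, E) M → ℝ) (u : TangentBundle 𝓘(ℝ, E) M)
    (p : E × E) : ℝ :=
  1 / 2 * L ((extChartAt 𝓘(ℝ, E).tangent u).symm p) ^ 2

lemma IsFinsler.contDiffAt_fibreEnergy (hL : IsFinsler L) (x : M) {y : E} (hy : y ≠ 0) :
    ContDiffAt ℝ ∞ (fibreEnergy L x) y := by
  have hslit : fibreIncl x y ∈ slit E M := hy
  have hfibre : ContMDiffAt 𝓘(ℝ, E) 𝓘(ℝ, ℝ) ∞ (L ∘ fibreIncl x) y :=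
    ((hL.smooth _ hslit).contMDiffAt (isOpen_slit.mem_nhds hslit)).comp y (contMDiff_fibreIncl x y)
  exact contDiffAt_const.mul (hfibre.contDiffAt.pow 2)

lemma IsFinsler.contDiffAt_fderiv_fderiv_fibreEnergy (hL : IsFinsler L) (x : M) {y : E}
    (hy : y ≠ 0) : ContDiffAt ℝ ∞ (fderiv ℝ (fderiv ℝ (fibreEnergy L x))) y :=
  ((hL.contDiffAt_fibreEnergy x hy).fderiv_right (m := ∞) (by simp)).fderiv_right (m := ∞) (by simp)

lemma IsFinsler.fderiv_fderiv_fibreEnergy_smul (hL : IsFinsler L) (x : M) {t : ℝ} (ht : 0 < t)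
    (y : E) :
    fderiv ℝ (fderiv ℝ (fibreEnergy L x)) (t • y) = fderiv ℝ (fderiv ℝ (fibreEnergy L x)) y := by
  have henergy (z : E) : fibreEnergy L x (t • z) = t ^ 2 • fibreEnergy L x z := by
    have hz : L (fibreIncl x (t • z)) = t * L (fibreIncl x z) := hL.homogeneous x z t ht
    rw [fibreEnergy, fibreEnergy, hz, smul_eq_mul]
    ring
  simpa using fderiv_smul_of_homogeneous (n := 0) ht.ne'
    (fderiv_smul_of_homogeneous (n := 1) ht.ne' henergy · |>.trans (by simp)) y

lemma IsFinsler.metric_symm (hL : IsFinsler L) (hu : u ∈ slit E M) (v w : PiTM E M u) :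
    metric L u v w = metric L u w v :=
  ((hL.contDiffAt_fibreEnergy u.proj (y := fibreCoord u) hu).isSymmSndFDerivAt
    (by simpa using ENat.LEInfty.out)).eq v w

lemma IsFinsler.separatingLeft_metric (hL : IsFinsler L) (hu : u ∈ slit E M) :
    (metric L u).toLinearMap₁₂.SeparatingLeft := by
  intro v hv
  by_contra hne
  exact (hL.posDef u hu v hne).ne' (hv v)

lemma IsFinsler.cartanTensor_swap_left (hL : IsFinsler L) (hu : u ∈ slit E M)
    (a b c : PiTM E M u) : cartanTensor L u a b c = cartanTensor L u b a c := by
  have henergy := (hL.contDiffAt_fibreEnergy u.proj (y := fibreCoord u) hu).fderiv_right (m := ∞)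
    (by simp)
  exact DFunLike.congr_fun ((henergy.isSymmSndFDerivAt (by simpa using ENat.LEInfty.out)).eq a b) c

lemma IsFinsler.cartanTensor_eta (hL : IsFinsler L) (hu : u ∈ slit E M) (b c : PiTM E M u) :
    cartanTensor L u (eta u) b c = 0 := by
  have hradial : fderiv ℝ (fderiv ℝ (fderiv ℝ (fibreEnergy L u.proj))) (fibreCoord u)
      (fibreCoord u) = 0 :=
    fderiv_apply_self_of_smul_eq
      ((hL.contDiffAt_fderiv_fderiv_fibreEnergy u.proj hu).differentiableAt (by simp))
      fun _ ht ↦ hL.fderiv_fderiv_fibreEnergy_smul u.proj ht (fibreCoord u)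
  exact DFunLike.congr_fun (DFunLike.congr_fun hradial b) c

lemma hasFDerivAt_comp_fibreIncl {f : TangentBundle 𝓘(ℝ, E) M → ℝ}
    (hf : MDifferentiableAt 𝓘(ℝ, E).tangent 𝓘(ℝ, ℝ) f u) :
    HasFDerivAt (f ∘ fibreIncl u.proj)
      (mvfderiv 𝓘(ℝ, E).tangent f u ∘L gamma u ∘L fibreId u) (fibreCoord u) :=
  (HasMFDerivAt.comp (fibreCoord u) (f := fibreIncl u.proj) (g := f) (I' := 𝓘(ℝ, E).tangent)
    hf.hasMFDerivAt (hasMFDerivAt_fibreIncl u)).hasFDerivAt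

lemma IsFinsler.contDiffAt_localEnergy (hL : IsFinsler L) (hw : w ∈ chartDom u)
    (hws : w ∈ slit E M) :
    ContDiffAt ℝ ∞ (localEnergy L u) (extChartAt 𝓘(ℝ, E).tangent u w) :=
  contDiffAt_const.mul ((contDiffAt_comp_extChartAt_symm (by rwa [extChartAt_tangent_source])
    ((hL.smooth w hws).contMDiffAt (isOpen_slit.mem_nhds hws))).pow 2)

lemma IsFinsler.metric_eq_fderiv_fderiv_localEnergy (hL : IsFinsler L) (hw : w ∈ chartDom u)
    (hws : w ∈ slit E M) (a b : PiTM E M w) :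
    metric L w a b = fderiv ℝ (fderiv ℝ (localEnergy L u)) (extChartAt 𝓘(ℝ, E).tangent u w)
      (0, toModel u w a) (0, toModel u w b) := by
  have henergy : fibreEnergy L w.proj
      = localEnergy L u ∘ (extChartAt 𝓘(ℝ, E).tangent u ∘ fibreIncl w.proj) := by
    ext1 y
    have hy : fibreIncl w.proj y ∈ (extChartAt 𝓘(ℝ, E).tangent u).source := by
      rwa [extChartAt_tangent_source]
    simp only [Function.comp_apply, localEnergy, fibreEnergy,
      (extChartAt 𝓘(ℝ, E).tangent u).left_inv hy]
  exact (DFunLike.congr_fun (DFunLike.congr_fun (congrArg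
    (fun f ↦ fderiv ℝ (fderiv ℝ f) (fibreCoord w)) henergy) a) b).trans
    (fderiv_fderiv_comp_affine (hasFDerivAt_extChartAt_comp_fibreIncl hw)
      ((hL.contDiffAt_localEnergy hw hws).of_le ENat.LEInfty.out) a b)

lemma IsFinsler.contMDiffAt_metric (hL : IsFinsler L) (hu : u ∈ slit E M)
    {Y Z : Π u : TangentBundle 𝓘(ℝ, E) M, PiTM E M u}
    (hY : IsSmoothPiField Y) (hZ : IsSmoothPiField Z) :
    ContMDiffAt 𝓘(ℝ, E).tangent 𝓘(ℝ, ℝ) ∞ (fun q ↦ metric L q (Y q) (Z q)) u := by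
  have hu' := mem_chartDom_self u
  have hhess : ContDiffAt ℝ ∞ (fderiv ℝ (fderiv ℝ (localEnergy L u)))
      (extChartAt 𝓘(ℝ, E).tangent u u) :=
    ((hL.contDiffAt_localEnergy hu' hu).fderiv_right (m := ∞) (by simp)).fderiv_right
      (m := ∞) (by simp)
  have hpair {Y : Π u : TangentBundle 𝓘(ℝ, E) M, PiTM E M u} (hY : IsSmoothPiField Y) :
      ContMDiffAt 𝓘(ℝ, E).tangent 𝓘(ℝ, E × E) ∞ (fun q ↦ ((0 : E), toModel u q (Y q))) u :=
    (contMDiffAt_const (c := (0 : E))).prodMk_space (hY.contMDiffAt hu' hu)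
  refine (((hhess.contMDiffAt.comp u (contMDiffAt_extChartAt_tangent hu')).clm_apply
    (hpair hY)).clm_apply (hpair hZ)).congr_of_eventuallyEq ?_
  filter_upwards [chartDom_mem_nhds u, isOpen_slit.mem_nhds hu] with q hqu hq
  exact hL.metric_eq_fderiv_fderiv_localEnergy hqu hq _ _

end Energy

section Regular

variable {D : PreConnection E M} {u : TangentBundle 𝓘(ℝ, E) M}

lemma IsRegular.exists_horizontal (hD : IsRegular D) (hu : u ∈ slit E M) (v : PiTM E M u) :
    ∃ X ∈ (horizontal D u : Set (TangentSpace 𝓘(ℝ, E).tangent u)), rho u X = v := by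
  obtain ⟨X, hX⟩ := rho_surjective u v
  obtain ⟨Y, hY, Z, hZ, rfl⟩ :=
    Submodule.mem_sup.1 ((hD u hu).sup_eq_top ▸ Submodule.mem_top (x := X))
  have hY_zero : rho u Y = 0 := hY
  exact ⟨Z, hZ, by rw [← hX, map_add, hY_zero, zero_add]⟩

lemma IsRegular.rho_beta (hD : IsRegular D) (hu : u ∈ slit E M) (v : PiTM E M u) :
    rho u (beta D u v) = v :=
  Function.invFunOn_eq (hD.exists_horizontal hu v)

lemma IsRegular.cov_eta_beta (hD : IsRegular D) (hu : u ∈ slit E M) (v : PiTM E M u) :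
    D eta u (beta D u v) = 0 :=
  Function.invFunOn_mem (hD.exists_horizontal hu v)

lemma IsRegular.eq_beta (hD : IsRegular D) (hu : u ∈ slit E M) {v : PiTM E M u}
    {X : TangentSpace 𝓘(ℝ, E).tangent u} (hrho : rho u X = v) (hcov : D eta u X = 0) :
    X = beta D u v := by
  rw [← sub_eq_zero]
  refine Submodule.disjoint_def.1 (hD u hu).disjoint _ ?_ ?_
  · change rho u (X - beta D u v) = 0
    rw [map_sub, hrho, hD.rho_beta hu, sub_self]
  · change D eta u (X - beta D u v) = 0
    rw [map_sub, hcov, hD.cov_eta_beta hu, sub_self]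

lemma IsRegular.exists_eq_gamma_add_beta (hD : IsRegular D) (hu : u ∈ slit E M)
    (X : TangentSpace 𝓘(ℝ, E).tangent u) : ∃ v, X = gamma u v + beta D u (rho u X) := by
  obtain ⟨v, hv⟩ := exists_gamma_eq_of_rho_eq_zero (X := X - beta D u (rho u X))
    (by rw [map_sub, hD.rho_beta hu, sub_self])
  exact ⟨v, by rw [hv, sub_add_cancel]⟩

end Regular

section FlatConnection

variable {u : TangentBundle 𝓘(ℝ, E) M}

/-- The operator differentiating, at each `u`, the coordinates of a section in the chart at `π u`.
It obeys the Leibniz rule, hence serves as a reference point for connections; since the chart varies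
with `u`, it is not a smooth connection. -/
noncomputable def flatConnection : PreConnection E M := fun Y u ↦
  fibreId u ∘L mvfderiv 𝓘(ℝ, E).tangent (fun q ↦ toModel u q (Y q)) u

lemma isCovariantDerivativeOn_flatConnection (s : Set (TangentBundle 𝓘(ℝ, E) M)) :
    IsCovariantDerivativeOn E (flatConnection (E := E) (M := M)) s where
  add {Y Z u} hY hZ _ := by
    have hadd : (fun q ↦ toModel u q ((Y + Z) q))
        = fun q ↦ toModel u q (Y q) + toModel u q (Z q) := funext fun _ ↦ map_add _ _ _
    rw [flatConnection, hadd, mvfderiv_fun_add (mdifferentiableAt_piField_iff.1 hY)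
      (mdifferentiableAt_piField_iff.1 hZ), ContinuousLinearMap.comp_add]
    rfl
  leibniz {Y f u} hY hf _ := by
    have hsmul : (fun q ↦ toModel u q ((f • Y) q)) = fun q ↦ f q • toModel u q (Y q) :=
      funext fun _ ↦ map_smul _ _ _
    rw [flatConnection, hsmul, mvfderiv_fun_smul hf (mdifferentiableAt_piField_iff.1 hY)]
    ext X
    simp [flatConnection, fibreId_toModel]

lemma flatConnection_eta_gamma (u : TangentBundle 𝓘(ℝ, E) M) (v : PiTM E M u) :
    flatConnection eta u (gamma u v) = v := by
  have hsnd : HasMFDerivAt 𝓘(ℝ, E × E) 𝓘(ℝ, E) (Prod.snd : E × E → E)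
      (extChartAt 𝓘(ℝ, E).tangent u u) (ContinuousLinearMap.snd ℝ E E) :=
    (ContinuousLinearMap.snd ℝ E E).hasMFDerivAt
  have heta : HasMFDerivAt 𝓘(ℝ, E).tangent 𝓘(ℝ, E) (fun q ↦ toModel u q (eta q)) u
      ((ContinuousLinearMap.snd ℝ E E).comp (chartDeriv u u)) := by
    refine (hsnd.comp u
      (hasMFDerivAt_extChartAt_tangent (mem_chartDom_self u))).congr_of_eventuallyEq ?_
    filter_upwards [chartDom_mem_nhds u] with q hq
    exact (congrArg Prod.snd (extChartAt_tangent_apply hq)).symm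
  calc flatConnection eta u (gamma u v) = fibreId u (chartDeriv u u (gamma u v)).2 := by
        rw [flatConnection, mvfderiv, heta.mfderiv]; rfl
    _ = v := by rw [chartDeriv_gamma (mem_chartDom_self u), fibreId_toModel]

variable [FiniteDimensional ℝ E]

lemma flatConnection_coordField (u : TangentBundle 𝓘(ℝ, E) M) (v : PiTM E M u) :
    flatConnection (coordField u v) u = 0 := by
  have hconst : HasMFDerivAt 𝓘(ℝ, E).tangent 𝓘(ℝ, E)
      (fun q ↦ toModel u q (coordField u v q)) u 0 := by
    refine (hasMFDerivAt_const (toModel u u v) u).congr_of_eventuallyEq ?_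
    filter_upwards [coordField_eventuallyEq_self u v, chartDom_mem_nhds u] with q hq hqu
    rw [hq, toModel_ofModel hqu]
  rw [flatConnection, mvfderiv, hconst.mfderiv]
  ext X
  simp

variable [T2Space M] {D D' : PreConnection E M}

lemma cov_sub_cov_eq (hD : IsCovariantDerivativeOn E D (slit E M))
    (hD' : IsCovariantDerivativeOn E D' (slit E M)) (hu : u ∈ slit E M)
    {Y : Π u : TangentBundle 𝓘(ℝ, E) M, PiTM E M u}
    (hY : MDifferentiableAt 𝓘(ℝ, E).tangent (𝓘(ℝ, E).tangent.prod 𝓘(ℝ, E))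
      (fun q ↦ (⟨q, Y q⟩ : TotalSpace E (PiTM E M))) u) :
    D' Y u - D Y u = D' (coordField u (Y u)) u - D (coordField u (Y u)) u := by
  rw [← hD'.difference_apply hD hu hY, ← hD'.difference_apply hD hu
    ((isSmoothPiField_coordField u (Y u)).mdifferentiableAt hu), coordField_self]

lemma cov_eq_flatConnection_add (hD : IsCovariantDerivativeOn E D (slit E M)) (hu : u ∈ slit E M)
    {Y : Π u : TangentBundle 𝓘(ℝ, E) M, PiTM E M u} (hY : IsSmoothPiField Y) :
    D Y u = flatConnection Y u + D (coordField u (Y u)) u := by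
  rw [← sub_eq_iff_eq_add', cov_sub_cov_eq (isCovariantDerivativeOn_flatConnection _) hD hu
    (hY.mdifferentiableAt hu), flatConnection_coordField, sub_zero]

end FlatConnection

section Torsion

variable [FiniteDimensional ℝ E] {D : PreConnection E M} {u : TangentBundle 𝓘(ℝ, E) M}

lemma IsRegular.rho_beta_coordField_eventuallyEq (hD : IsRegular D) (hu : u ∈ slit E M)
    (w : PiTM E M u) :
    ∀ᶠ q in 𝓝 u, rho q (beta D q (coordField u w q)) = ofModel u q (toModel u u w) := by
  filter_upwards [isOpen_slit.mem_nhds hu, coordField_eventuallyEq_self u w] with q hq hqw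
  rw [hD.rho_beta hq, hqw]

variable [T2Space M]

lemma cov_rho_beta_coordField (hD : IsCovariantDerivativeOn E D (slit E M)) (hreg : IsRegular D)
    (hu : u ∈ slit E M) (w : PiTM E M u) :
    D (fun q ↦ rho q (beta D q (coordField u w q))) u = D (coordField u w) u := by
  have hrho : ∀ᶠ q in 𝓝 u, rho q (beta D q (coordField u w q)) = coordField u w q := by
    filter_upwards [isOpen_slit.mem_nhds hu] with q hq using hreg.rho_beta hq _
  have hw := (isSmoothPiField_coordField u w).mdifferentiableAt hu
  refine hD.congr_of_eventuallyEq (hw.congr_of_eventuallyEq ?_) hw (isOpen_slit.mem_nhds hu) hrho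
  filter_upwards [hrho] with q hq
  rw [hq]

lemma hhvTorsion_coordField (hD : IsCovariantDerivativeOn E D (slit E M)) (hreg : IsRegular D)
    (hu : u ∈ slit E M) (v w : PiTM E M u) :
    hhvTorsion D (coordField u v) (coordField u w) u = D (coordField u w) u (gamma u v) := by
  have hrho : (fun q ↦ rho q (gamma q (coordField u v q))) = 0 := funext fun q ↦ rho_gamma q _
  have hbracket := rho_mlieBracket_eq_zero (V := fun q ↦ gamma q (coordField u v q))
    (W := fun q ↦ beta D q (coordField u w q)) (u := u) (v := 0) (w := toModel u u w)
    (.of_forall fun q ↦ by rw [rho_gamma, map_zero]) (hreg.rho_beta_coordField_eventuallyEq hu w)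
  rw [hhvTorsion, torsion, hrho, hbracket, hD.zero hu, cov_rho_beta_coordField hD hreg hu]
  simp

lemma hhTorsion_coordField (hD : IsCovariantDerivativeOn E D (slit E M)) (hreg : IsRegular D)
    (hu : u ∈ slit E M) (v w : PiTM E M u) :
    hhTorsion D (coordField u v) (coordField u w) u
      = D (coordField u w) u (beta D u v) - D (coordField u v) u (beta D u w) := by
  have hbracket := rho_mlieBracket_eq_zero (V := fun q ↦ beta D q (coordField u v q))
    (W := fun q ↦ beta D q (coordField u w q)) (u := u)
    (hreg.rho_beta_coordField_eventuallyEq hu v) (hreg.rho_beta_coordField_eventuallyEq hu w)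
  rw [hhTorsion, torsion, hbracket, cov_rho_beta_coordField hD hreg hu,
    cov_rho_beta_coordField hD hreg hu]
  simp

end Torsion

section Cartan

variable [FiniteDimensional ℝ E] [T2Space M] {L : TangentBundle 𝓘(ℝ, E) M → ℝ}
  {D : PreConnection E M} {u : TangentBundle 𝓘(ℝ, E) M}

lemma IsFinsler.mvfderiv_metric_coordField_gamma (hL : IsFinsler L) (hu : u ∈ slit E M)
    (a b c : PiTM E M u) :
    mvfderiv 𝓘(ℝ, E).tangent (fun q ↦ metric L q (coordField u b q) (coordField u c q)) u
      (gamma u a) = cartanTensor L u a b c := by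
  have hfibre : (fun q ↦ metric L q (coordField u b q) (coordField u c q)) ∘ fibreIncl u.proj
      = fun y ↦ fderiv ℝ (fderiv ℝ (fibreEnergy L u.proj)) y (toModel u u b) (toModel u u c) := by
    ext1 y
    simp only [Function.comp_apply, coordField_fibreIncl]
    rfl
  have hderiv := hasFDerivAt_comp_fibreIncl ((hL.contMDiffAt_metric hu
    (isSmoothPiField_coordField u b) (isSmoothPiField_coordField u c)).mdifferentiableAt (by simp))
  have hhess := (hL.contDiffAt_fderiv_fderiv_fibreEnergy u.proj (y := fibreCoord u)
    hu).differentiableAt (by simp)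
  have hmodel (v : PiTM E M u) : toModel u u v = v := fibreId_toModel u v
  rw [hfibre] at hderiv
  calc mvfderiv 𝓘(ℝ, E).tangent (fun q ↦ metric L q (coordField u b q) (coordField u c q)) u
        (gamma u a)
      = fderiv ℝ (fun y ↦ fderiv ℝ (fderiv ℝ (fibreEnergy L u.proj)) y (toModel u u b)
          (toModel u u c)) (fibreCoord u) (toModel u u a) := by
        rw [hderiv.fderiv, ContinuousLinearMap.comp_apply, ContinuousLinearMap.comp_apply,
          fibreId_toModel]
    _ = cartanTensor L u a b c := by
        rw [fderiv_clm_apply_const (hhess.clm_apply (differentiableAt_const _)),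
          fderiv_clm_apply_const hhess, hmodel, hmodel, hmodel]
        rfl

lemma IsCartanConnection.metric_cov_coordField_gamma_swap (hD : IsCartanConnection L D)
    (hu : u ∈ slit E M) (a b c : PiTM E M u) :
    metric L u (D (coordField u b) u (gamma u a)) c
      = metric L u (D (coordField u c) u (gamma u a)) b := by
  have hswap := hD.hhvTorsion_symm _ _ _ (isSmoothPiField_coordField u a)
    (isSmoothPiField_coordField u b) (isSmoothPiField_coordField u c) u hu
  rwa [hhvTorsion_coordField hD.isConnection.isCovariantDerivativeOn hD.isRegular hu,
    hhvTorsion_coordField hD.isConnection.isCovariantDerivativeOn hD.isRegular hu,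
    coordField_self, coordField_self] at hswap

lemma IsCartanConnection.two_mul_metric_cov_coordField_gamma (hD : IsCartanConnection L D)
    (hu : u ∈ slit E M) (hsymm : ∀ v w, metric L u v w = metric L u w v) (a b c : PiTM E M u) :
    2 * metric L u (D (coordField u b) u (gamma u a)) c
      = mvfderiv 𝓘(ℝ, E).tangent (fun q ↦ metric L q (coordField u b q) (coordField u c q)) u
        (gamma u a) := by
  rw [hD.isMetric _ _ (isSmoothPiField_coordField u b) (isSmoothPiField_coordField u c) u hu,
    coordField_self, coordField_self, hsymm b, hD.metric_cov_coordField_gamma_swap hu a c b,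
    two_mul]

lemma IsCartanConnection.two_mul_metric_cov_coordField_gamma_eq_cartanTensor
    (hD : IsCartanConnection L D) (hL : IsFinsler L) (hu : u ∈ slit E M) (a b c : PiTM E M u) :
    2 * metric L u (D (coordField u b) u (gamma u a)) c = cartanTensor L u a b c := by
  rw [hD.two_mul_metric_cov_coordField_gamma hu (hL.metric_symm hu),
    hL.mvfderiv_metric_coordField_gamma hu]

lemma IsCartanConnection.cov_coordField_gamma_comm (hD : IsCartanConnection L D)
    (hL : IsFinsler L) (hu : u ∈ slit E M) (a b : PiTM E M u) :
    D (coordField u b) u (gamma u a) = D (coordField u a) u (gamma u b) := by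
  refine sub_eq_zero.1 (hL.separatingLeft_metric hu _ fun c ↦ ?_)
  have hcomm := hL.cartanTensor_swap_left hu a b c
  rw [← hD.two_mul_metric_cov_coordField_gamma_eq_cartanTensor hL hu,
    ← hD.two_mul_metric_cov_coordField_gamma_eq_cartanTensor hL hu] at hcomm
  change metric L u (_ - _) c = 0
  rw [map_sub, sub_apply]
  linarith

lemma IsCartanConnection.cov_coordField_gamma_eta (hD : IsCartanConnection L D)
    (hL : IsFinsler L) (hu : u ∈ slit E M) (b : PiTM E M u) :
    D (coordField u b) u (gamma u (eta u)) = 0 := by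
  refine hL.separatingLeft_metric hu _ fun c ↦ ?_
  have hradial := hD.two_mul_metric_cov_coordField_gamma_eq_cartanTensor hL hu (eta u) b c
  rw [hL.cartanTensor_eta hu] at hradial
  exact (mul_eq_zero.1 hradial).resolve_left two_ne_zero

lemma IsCartanConnection.cov_eta_gamma (hD : IsCartanConnection L D) (hL : IsFinsler L)
    (hu : u ∈ slit E M) (v : PiTM E M u) : D eta u (gamma u v) = v := by
  rw [cov_eq_flatConnection_add hD.isConnection.isCovariantDerivativeOn hu isSmoothPiField_eta,
    add_apply, hD.cov_coordField_gamma_comm hL hu, hD.cov_coordField_gamma_eta hL hu, add_zero,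
    flatConnection_eta_gamma]

lemma IsCartanConnection.cov_coordField_beta_comm (hD : IsCartanConnection L D) (hu : u ∈ slit E M)
    (v w : PiTM E M u) :
    D (coordField u w) u (beta D u v) = D (coordField u v) u (beta D u w) := by
  rw [← sub_eq_zero, ← hhTorsion_coordField hD.isConnection.isCovariantDerivativeOn hD.isRegular hu]
  exact hD.hhTorsion_eq_zero _ _ (isSmoothPiField_coordField u v) (isSmoothPiField_coordField u w)
    u hu

end Cartan

section BasicForms

variable {f : TangentBundle 𝓘(ℝ, E) M → ℝ} {α : Π q : TangentBundle 𝓘(ℝ, E) M, PiTM E M q →L[ℝ] ℝ}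
  {u : TangentBundle 𝓘(ℝ, E) M}

lemma eventually_fderiv_comp_extChartAt_symm_eq (hf : ContMDiffAt 𝓘(ℝ, E).tangent 𝓘(ℝ, ℝ) 2 f u)
    (hα : ∀ᶠ q in 𝓝 u, ∀ X, mvfderiv 𝓘(ℝ, E).tangent f q X = α q (rho q X)) :
    ∀ᶠ q in 𝓝 u, ∀ k : E × E, fderiv ℝ (f ∘ (extChartAt 𝓘(ℝ, E).tangent u).symm)
      (extChartAt 𝓘(ℝ, E).tangent u q) k = α q (ofModel u q k.1) := by
  have : IsManifold 𝓘(ℝ, E).tangent 2 (TangentBundle 𝓘(ℝ, E) M) := .of_le (n := ∞) ENat.LEInfty.out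
  have : IsManifold 𝓘(ℝ, E).tangent 1 (TangentBundle 𝓘(ℝ, E) M) := .of_le (n := ∞) ENat.LEInfty.out
  filter_upwards [hα, (contMDiffAt_iff_contMDiffAt_nhds (by simp)).1 hf,
    chartDom_mem_nhds u] with q hq hfq hqu k
  obtain ⟨X, hX⟩ := (chartDeriv_isInvertible hqu).bijective.2 k
  have hderiv := mvfderiv_eq_fderiv_comp_extChartAt_symm (x := u)
    (by rwa [extChartAt_tangent_source]) (hfq.mdifferentiableAt two_ne_zero) X
  rw [← hX, chartDeriv_fst hqu, ofModel_toModel hqu, ← hq]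
  exact hderiv.symm

-- The coordinates of `α` are the partial derivatives of `f` along `M`; those along the fibre
-- vanish, and second partial derivatives commute.
lemma mvfderiv_apply_ofModel_gamma_eq_zero (hf : ContMDiffAt 𝓘(ℝ, E).tangent 𝓘(ℝ, ℝ) 2 f u)
    (hα : ∀ᶠ q in 𝓝 u, ∀ X, mvfderiv 𝓘(ℝ, E).tangent f q X = α q (rho q X)) (v : E)
    (b : PiTM E M u) :
    mvfderiv 𝓘(ℝ, E).tangent (fun q ↦ α q (ofModel u q v)) u (gamma u b) = 0 := by
  have : IsManifold 𝓘(ℝ, E).tangent 2 (TangentBundle 𝓘(ℝ, E) M) := .of_le (n := ∞) ENat.LEInfty.out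
  set φ := extChartAt 𝓘(ℝ, E).tangent u
  have hf' : ContDiffAt ℝ 2 (f ∘ φ.symm) (φ u) :=
    contDiffAt_comp_extChartAt_symm (mem_extChartAt_source u) hf
  have hpartial := eventually_fderiv_comp_extChartAt_symm_eq hf hα
  have hvertical : ∀ᶠ p in 𝓝 (φ u), fderiv ℝ (f ∘ φ.symm) p (0, toModel u u b) = 0 := by
    filter_upwards [eventually_extChartAt_tangent_symm hpartial,
      extChartAt_target_mem_nhds (I := 𝓘(ℝ, E).tangent) u] with p hp hp_target
    rw [← φ.right_inv hp_target, hp, map_zero, map_zero]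
  have hcoord : HasMFDerivAt 𝓘(ℝ, E).tangent 𝓘(ℝ, ℝ) (fun q ↦ α q (ofModel u q v)) u
      (fderiv ℝ (fun p ↦ fderiv ℝ (f ∘ φ.symm) p (v, 0)) (φ u) ∘L chartDeriv u u) := by
    refine (((differentiableAt_fderiv_of_contDiffAt hf').clm_apply
      (differentiableAt_const (v, (0 : E)))).hasFDerivAt.hasMFDerivAt.comp u
      (hasMFDerivAt_extChartAt_tangent (mem_chartDom_self u))).congr_of_eventuallyEq ?_
    filter_upwards [hpartial] with q hq
    exact (hq (v, 0)).symm
  calc mvfderiv 𝓘(ℝ, E).tangent (fun q ↦ α q (ofModel u q v)) u (gamma u b)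
      = fderiv ℝ (fun p ↦ fderiv ℝ (f ∘ φ.symm) p (v, 0)) (φ u) (chartDeriv u u (gamma u b)) :=
        DFunLike.congr_fun hcoord.mfderiv (gamma u b)
    _ = 0 := by
        rw [chartDeriv_gamma (mem_chartDom_self u), fderiv_fderiv_apply_eq_zero hf' hvertical]

end BasicForms

section Concurrent

variable {L L' : TangentBundle 𝓘(ℝ, E) M → ℝ}
  {D : PreConnection E M} {ζ : Π u : TangentBundle 𝓘(ℝ, E) M, PiTM E M u}
  {u : TangentBundle 𝓘(ℝ, E) M}

lemma IsConcurrent.mvfderiv_half_metric_self (hζ : IsConcurrent D ζ) (hL : IsFinsler L)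
    (hD : IsCartanConnection L D) (hu : u ∈ slit E M) (X : TangentSpace 𝓘(ℝ, E).tangent u) :
    mvfderiv 𝓘(ℝ, E).tangent (fun q ↦ -(1 / 2) * metric L q (ζ q) (ζ q)) u X
      = metric L u (ζ u) (rho u X) := by
  have hsmooth := (hL.contMDiffAt_metric hu hζ.smooth hζ.smooth).mdifferentiableAt (by simp)
  have hmetric := hD.isMetric _ _ hζ.smooth hζ.smooth u hu X
  rw [hζ.cov_eq u hu, hL.metric_symm hu, map_neg] at hmetric
  rw [mvfderiv_fun_mul mdifferentiableAt_const hsmooth, mvfderiv_const, smul_zero, add_zero,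
    smul_apply, hmetric, smul_eq_mul]
  ring

/-- The function `B = g(ζ, η)`, whose square is added to `L²` by the change of Finsler structure. -/
noncomputable def etaPairing (L : TangentBundle 𝓘(ℝ, E) M → ℝ)
    (ζ : Π u : TangentBundle 𝓘(ℝ, E) M, PiTM E M u) (u : TangentBundle 𝓘(ℝ, E) M) : ℝ :=
  metric L u (ζ u) (eta u)

lemma IsConcurrent.contMDiffAt_etaPairing (hζ : IsConcurrent D ζ) (hL : IsFinsler L)
    (hu : u ∈ slit E M) : ContMDiffAt 𝓘(ℝ, E).tangent 𝓘(ℝ, ℝ) ∞ (etaPairing L ζ) u :=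
  hL.contMDiffAt_metric hu hζ.smooth isSmoothPiField_eta

lemma IsConcurrent.contDiffAt_etaPairing_comp_fibreIncl (hζ : IsConcurrent D ζ) (hL : IsFinsler L)
    (x : M) {y : E} (hy : y ≠ 0) : ContDiffAt ℝ ∞ (etaPairing L ζ ∘ fibreIncl x) y :=
  (ContMDiffAt.comp y (hζ.contMDiffAt_etaPairing hL (u := fibreIncl x y) hy)
    (contMDiff_fibreIncl x y)).contDiffAt

variable [FiniteDimensional ℝ E]

lemma IsConcurrent.mvfderiv_metric_coordField_gamma (hζ : IsConcurrent D ζ) (hL : IsFinsler L)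
    (hD : IsCartanConnection L D) (hu : u ∈ slit E M) (v b : PiTM E M u) :
    mvfderiv 𝓘(ℝ, E).tangent (fun q ↦ metric L q (ζ q) (coordField u v q)) u (gamma u b) = 0 := by
  have hsmooth : ContMDiffAt 𝓘(ℝ, E).tangent 𝓘(ℝ, ℝ) 2
      (fun q ↦ -(1 / 2) * metric L q (ζ q) (ζ q)) u :=
    contMDiffAt_const.mul ((hL.contMDiffAt_metric hu hζ.smooth hζ.smooth).of_le ENat.LEInfty.out)
  have hcoord : (fun q ↦ metric L q (ζ q) (coordField u v q))
      =ᶠ[𝓝 u] fun q ↦ metric L q (ζ q) (ofModel u q (toModel u u v)) := by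
    filter_upwards [coordField_eventuallyEq_self u v] with q hq
    rw [hq]
  rw [mvfderiv_eq_of_eventuallyEq hcoord]
  refine mvfderiv_apply_ofModel_gamma_eq_zero (α := fun q ↦ metric L q (ζ q)) hsmooth ?_ _ b
  filter_upwards [isOpen_slit.mem_nhds hu] with q hq X
  exact hζ.mvfderiv_half_metric_self hL hD hq X

variable [T2Space M]

lemma IsConcurrent.mvfderiv_metric_coordField (hζ : IsConcurrent D ζ) (hD : IsCartanConnection L D)
    (hu : u ∈ slit E M) (v : PiTM E M u) (X : TangentSpace 𝓘(ℝ, E).tangent u) :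
    mvfderiv 𝓘(ℝ, E).tangent (fun q ↦ metric L q (ζ q) (coordField u v q)) u X
      = -metric L u (rho u X) v + metric L u (ζ u) (D (coordField u v) u X) := by
  rw [hD.isMetric _ _ hζ.smooth (isSmoothPiField_coordField u v) u hu X, hζ.cov_eq u hu,
    coordField_self, map_neg]
  rfl

lemma IsConcurrent.metric_cov_coordField_gamma (hζ : IsConcurrent D ζ) (hL : IsFinsler L)
    (hD : IsCartanConnection L D) (hu : u ∈ slit E M) (v b : PiTM E M u) :
    metric L u (ζ u) (D (coordField u v) u (gamma u b)) = 0 := by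
  have hconst := hζ.mvfderiv_metric_coordField_gamma hL hD hu v b
  rw [hζ.mvfderiv_metric_coordField hD hu, rho_gamma, map_zero] at hconst
  simpa using hconst

lemma IsConcurrent.cov_coordField_gamma (hζ : IsConcurrent D ζ) (hL : IsFinsler L)
    (hD : IsCartanConnection L D) (hu : u ∈ slit E M) (v : PiTM E M u) :
    D (coordField u v) u (gamma u (ζ u)) = 0 := by
  refine hL.separatingLeft_metric hu _ fun c ↦ ?_
  change metric L u (D (coordField u v) u (gamma u (ζ u))) c = 0
  rw [hD.cov_coordField_gamma_comm hL hu, hD.metric_cov_coordField_gamma_swap hu,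
    hL.metric_symm hu, hζ.metric_cov_coordField_gamma hL hD hu]

lemma IsConcurrent.mvfderiv_etaPairing_gamma (hζ : IsConcurrent D ζ) (hL : IsFinsler L)
    (hD : IsCartanConnection L D) (hu : u ∈ slit E M) (b : PiTM E M u) :
    mvfderiv 𝓘(ℝ, E).tangent (etaPairing L ζ) u (gamma u b) = metric L u (ζ u) b := by
  have hmetric := hD.isMetric _ _ hζ.smooth isSmoothPiField_eta u hu (gamma u b)
  change mvfderiv 𝓘(ℝ, E).tangent (fun q ↦ metric L q (ζ q) (eta q)) u (gamma u b) = _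
  rw [hζ.cov_eq u hu, rho_gamma, hD.cov_eta_gamma hL hu] at hmetric
  rw [hmetric, neg_zero, map_zero, zero_apply, zero_add]

lemma IsConcurrent.fderiv_etaPairing_comp_fibreIncl (hζ : IsConcurrent D ζ) (hL : IsFinsler L)
    (hD : IsCartanConnection L D) (x : M) {y : E} (hy : y ≠ 0) (b : E) :
    fderiv ℝ (etaPairing L ζ ∘ fibreIncl x) y b
      = metric L (fibreIncl x y) (ζ (fibreIncl x y)) (fibreId (fibreIncl x y) b) := by
  have hslit : fibreIncl x y ∈ slit E M := hy
  have hderiv := hasFDerivAt_comp_fibreIncl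
    ((hζ.contMDiffAt_etaPairing hL hslit).mdifferentiableAt (by simp))
  exact (DFunLike.congr_fun hderiv.fderiv b).trans (hζ.mvfderiv_etaPairing_gamma hL hD hslit _)

lemma IsConcurrent.fderiv_fderiv_etaPairing_comp_fibreIncl (hζ : IsConcurrent D ζ)
    (hL : IsFinsler L) (hD : IsCartanConnection L D) (hu : u ∈ slit E M) (v w : PiTM E M u) :
    fderiv ℝ (fderiv ℝ (etaPairing L ζ ∘ fibreIncl u.proj)) (fibreCoord u)
      (toModel u u v) (toModel u u w) = 0 := by
  have hu_ne : fibreCoord u ≠ 0 := hu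
  have hfst : (fun y ↦ fderiv ℝ (etaPairing L ζ ∘ fibreIncl u.proj) y (toModel u u w))
      =ᶠ[𝓝 (fibreCoord u)] (fun q ↦ metric L q (ζ q) (coordField u w q)) ∘ fibreIncl u.proj := by
    filter_upwards [isOpen_ne.mem_nhds hu_ne] with y hy
    rw [hζ.fderiv_etaPairing_comp_fibreIncl hL hD _ hy, Function.comp_apply, coordField_fibreIncl]
  have hsmooth := hL.contMDiffAt_metric hu hζ.smooth (isSmoothPiField_coordField u w)
  rw [← fderiv_clm_apply_const (differentiableAt_fderiv_of_contDiffAt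
      ((hζ.contDiffAt_etaPairing_comp_fibreIncl hL u.proj hu_ne).of_le ENat.LEInfty.out)),
    hfst.fderiv_eq, (hasFDerivAt_comp_fibreIncl (hsmooth.mdifferentiableAt (by simp))).fderiv]
  exact hζ.mvfderiv_metric_coordField_gamma hL hD hu w _

lemma IsConcurrent.metric_eq (hζ : IsConcurrent D ζ) (hL : IsFinsler L)
    (hD : IsCartanConnection L D)
    (hLL' : ∀ u ∈ slit E M, L' u ^ 2 = L u ^ 2 + metric L u (ζ u) (eta u) ^ 2)
    (hu : u ∈ slit E M) (v w : PiTM E M u) :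
    metric L' u v w = metric L u v w + metric L u (ζ u) v * metric L u (ζ u) w := by
  have hu_ne : fibreCoord u ≠ 0 := hu
  have henergy : fibreEnergy L' u.proj =ᶠ[𝓝 (fibreCoord u)] fun y ↦
      fibreEnergy L u.proj y + 1 / 2 * (etaPairing L ζ ∘ fibreIncl u.proj) y ^ 2 := by
    filter_upwards [isOpen_ne.mem_nhds hu_ne] with y hy
    rw [fibreEnergy, fibreEnergy, hLL' _ hy, mul_add]
    rfl
  have hhess := fderiv_fderiv_add_half_sq
    ((hL.contDiffAt_fibreEnergy u.proj hu_ne).of_le ENat.LEInfty.out)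
    ((hζ.contDiffAt_etaPairing_comp_fibreIncl hL u.proj hu_ne).of_le ENat.LEInfty.out)
    (toModel u u v) (toModel u u w)
  rw [← henergy.fderiv.fderiv_eq, hζ.fderiv_fderiv_etaPairing_comp_fibreIncl hL hD hu, mul_zero,
    add_zero, hζ.fderiv_etaPairing_comp_fibreIncl hL hD _ hu_ne,
    hζ.fderiv_etaPairing_comp_fibreIncl hL hD _ hu_ne] at hhess
  rw [← fibreId_toModel u v, ← fibreId_toModel u w]
  exact hhess

end Concurrent

section Change

lemma IsFinsler.one_add_metric_self_pos {L : TangentBundle 𝓘(ℝ, E) M → ℝ} (hL : IsFinsler L)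
    {u : TangentBundle 𝓘(ℝ, E) M} (hu : u ∈ slit E M) (v : PiTM E M u) :
    0 < 1 + metric L u v v := by
  rcases eq_or_ne v 0 with rfl | hv
  · simp
  · linarith [hL.posDef u hu v hv]

variable [FiniteDimensional ℝ E]

/-- The deviation of `D'` from the connection `D - g(ρ ·, ·) / (1 + p²) ζ`, evaluated on the
`D`-horizontal lift of `v` and a section with value `w` at `u`. The theorem amounts to its
vanishing when `D` and `D'` are the two Cartan connections. -/
noncomputable def changeDefect (L : TangentBundle 𝓘(ℝ, E) M → ℝ) (D D' : PreConnection E M)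
    (ζ : Π u : TangentBundle 𝓘(ℝ, E) M, PiTM E M u) (u : TangentBundle 𝓘(ℝ, E) M)
    (v w : PiTM E M u) : PiTM E M u :=
  D' (coordField u w) u (beta D u v) - D (coordField u w) u (beta D u v)
    + (metric L u v w / (1 + metric L u (ζ u) (ζ u))) • ζ u

lemma cov_coordField_beta_eq_add_changeDefect (L : TangentBundle 𝓘(ℝ, E) M → ℝ)
    (D D' : PreConnection E M) (ζ : Π u : TangentBundle 𝓘(ℝ, E) M, PiTM E M u)
    (u : TangentBundle 𝓘(ℝ, E) M) (v w : PiTM E M u) :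
    D' (coordField u w) u (beta D u v) = D (coordField u w) u (beta D u v)
      - (metric L u v w / (1 + metric L u (ζ u) (ζ u))) • ζ u + changeDefect L D D' ζ u v w := by
  rw [changeDefect]
  abel

variable [T2Space M] {L L' : TangentBundle 𝓘(ℝ, E) M → ℝ}
  {D D' : PreConnection E M} {ζ : Π u : TangentBundle 𝓘(ℝ, E) M, PiTM E M u}
  {u : TangentBundle 𝓘(ℝ, E) M} (hζ : IsConcurrent D ζ) (hL : IsFinsler L)
  (hD : IsCartanConnection L D) (hD' : IsCartanConnection L' D')
  (hLL' : ∀ u ∈ slit E M, L' u ^ 2 = L u ^ 2 + metric L u (ζ u) (eta u) ^ 2) (hu : u ∈ slit E M)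

include hζ hL hD hLL' hu

lemma IsConcurrent.metric_symm_change (v w : PiTM E M u) : metric L' u v w = metric L' u w v := by
  rw [hζ.metric_eq hL hD hLL' hu, hζ.metric_eq hL hD hLL' hu, hL.metric_symm hu, mul_comm]

lemma IsConcurrent.separatingLeft_metric_change : (metric L' u).toLinearMap₁₂.SeparatingLeft := by
  intro v hv
  by_contra hv_ne
  have hself : metric L' u v v = 0 := hv v
  rw [hζ.metric_eq hL hD hLL' hu] at hself
  linarith [hL.posDef u hu v hv_ne, mul_self_nonneg (metric L u (ζ u) v)]

lemma IsConcurrent.mvfderiv_metric_change (v w : PiTM E M u) (X : TangentSpace 𝓘(ℝ, E).tangent u) :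
    mvfderiv 𝓘(ℝ, E).tangent (fun q ↦ metric L' q (coordField u v q) (coordField u w q)) u X
      = mvfderiv 𝓘(ℝ, E).tangent (fun q ↦ metric L q (coordField u v q) (coordField u w q)) u X
        + metric L u (ζ u) v
          * (-metric L u (rho u X) w + metric L u (ζ u) (D (coordField u w) u X))
        + metric L u (ζ u) w
          * (-metric L u (rho u X) v + metric L u (ζ u) (D (coordField u v) u X)) := by
  have hv := isSmoothPiField_coordField u v
  have hw := isSmoothPiField_coordField u w
  have hvw := (hL.contMDiffAt_metric hu hv hw).mdifferentiableAt (by simp)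
  have hζv := (hL.contMDiffAt_metric hu hζ.smooth hv).mdifferentiableAt (by simp)
  have hζw := (hL.contMDiffAt_metric hu hζ.smooth hw).mdifferentiableAt (by simp)
  have hζvζw : MDifferentiableAt 𝓘(ℝ, E).tangent 𝓘(ℝ, ℝ) (fun q ↦
      metric L q (ζ q) (coordField u v q) * metric L q (ζ q) (coordField u w q)) u := hζv.mul hζw
  have hmetric : (fun q ↦ metric L' q (coordField u v q) (coordField u w q)) =ᶠ[𝓝 u] fun q ↦
      metric L q (coordField u v q) (coordField u w q)
        + metric L q (ζ q) (coordField u v q) * metric L q (ζ q) (coordField u w q) := by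
    filter_upwards [isOpen_slit.mem_nhds hu] with q hq
    exact hζ.metric_eq hL hD hLL' hq _ _
  rw [mvfderiv_eq_of_eventuallyEq hmetric, mvfderiv_fun_add hvw hζvζw,
    mvfderiv_fun_mul hζv hζw, add_apply, add_apply, smul_apply, smul_apply,
    hζ.mvfderiv_metric_coordField hD hu, hζ.mvfderiv_metric_coordField hD hu, coordField_self,
    coordField_self, smul_eq_mul, smul_eq_mul, add_assoc]

lemma IsConcurrent.metric_changeDefect (v w z : PiTM E M u) :
    metric L' u (changeDefect L D D' ζ u v w) z
      = metric L' u (D' (coordField u w) u (beta D u v)) z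
        - metric L' u (D (coordField u w) u (beta D u v)) z
        + metric L u v w * metric L u (ζ u) z := by
  have hpos : 1 + metric L u (ζ u) (ζ u) ≠ 0 := (hL.one_add_metric_self_pos hu (ζ u)).ne'
  have hscale : metric L' u (ζ u) z = (1 + metric L u (ζ u) (ζ u)) * metric L u (ζ u) z := by
    rw [hζ.metric_eq hL hD hLL' hu]
    ring
  rw [changeDefect, map_add, map_sub, map_smul, add_apply, sub_apply, smul_apply, hscale,
    smul_eq_mul, ← mul_assoc, div_mul_cancel₀ _ hpos]

include hD'

lemma IsConcurrent.cov_coordField_gamma_change (v w : PiTM E M u) :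
    D' (coordField u w) u (gamma u v) = D (coordField u w) u (gamma u v) := by
  refine sub_eq_zero.1 (hζ.separatingLeft_metric_change hL hD hLL' hu _ fun c ↦ ?_)
  have htwo : 2 * metric L' u (D' (coordField u w) u (gamma u v)) c
      = 2 * metric L u (D (coordField u w) u (gamma u v)) c := by
    rw [hD'.two_mul_metric_cov_coordField_gamma hu (hζ.metric_symm_change hL hD hLL' hu),
      hD.two_mul_metric_cov_coordField_gamma hu (hL.metric_symm hu),
      hζ.mvfderiv_metric_change hL hD hLL' hu, rho_gamma, hζ.metric_cov_coordField_gamma hL hD hu,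
      hζ.metric_cov_coordField_gamma hL hD hu]
    simp
  have hmetric := hζ.metric_eq hL hD hLL' hu (D (coordField u w) u (gamma u v)) c
  rw [hζ.metric_cov_coordField_gamma hL hD hu, zero_mul, add_zero] at hmetric
  change metric L' u (_ - _) c = 0
  rw [map_sub, sub_apply, hmetric]
  linarith

lemma IsConcurrent.cov_eta_gamma_change (v : PiTM E M u) : D' eta u (gamma u v) = v := by
  have hdiff := DFunLike.congr_fun (cov_sub_cov_eq hD.isConnection.isCovariantDerivativeOn
    hD'.isConnection.isCovariantDerivativeOn hu (isSmoothPiField_eta.mdifferentiableAt hu))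
    (gamma u v)
  rw [sub_apply, sub_apply, hζ.cov_coordField_gamma_change hL hD hD' hLL' hu, sub_self,
    hD.cov_eta_gamma hL hu] at hdiff
  exact sub_eq_zero.1 hdiff

lemma IsConcurrent.beta_eq_add_gamma_sub_changeDefect (v : PiTM E M u) :
    beta D' u v = beta D u v
      + gamma u ((metric L u v (eta u) / (1 + metric L u (ζ u) (ζ u))) • ζ u
        - changeDefect L D D' ζ u v (eta u)) := by
  refine (hD'.isRegular.eq_beta hu ?_ ?_).symm
  · rw [map_add, rho_gamma, hD.isRegular.rho_beta hu, add_zero]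
  · have hdiff := DFunLike.congr_fun (cov_sub_cov_eq hD.isConnection.isCovariantDerivativeOn
      hD'.isConnection.isCovariantDerivativeOn hu (isSmoothPiField_eta.mdifferentiableAt hu))
      (beta D u v)
    rw [sub_apply, sub_apply, hD.isRegular.cov_eta_beta hu, sub_zero] at hdiff
    rw [map_add, hζ.cov_eta_gamma_change hL hD hD' hLL' hu, hdiff, changeDefect]
    abel

lemma IsConcurrent.cov_coordField_beta_eq_sub_changeDefect (v w : PiTM E M u) :
    D' (coordField u w) u (beta D' u v)
      = D (coordField u w) u (beta D u v)
        - (metric L u v w / (1 + metric L u (ζ u) (ζ u))) • ζ u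
        + changeDefect L D D' ζ u v w
        - D (coordField u w) u (gamma u (changeDefect L D D' ζ u v (eta u))) := by
  rw [hζ.beta_eq_add_gamma_sub_changeDefect hL hD hD' hLL' hu, map_add,
    hζ.cov_coordField_gamma_change hL hD hD' hLL' hu, map_sub, map_sub, map_smul, map_smul,
    hζ.cov_coordField_gamma hL hD hu, smul_zero, cov_coordField_beta_eq_add_changeDefect L D D' ζ]
  abel

lemma IsConcurrent.changeDefect_torsion (v w : PiTM E M u) :
    changeDefect L D D' ζ u v w - changeDefect L D D' ζ u w v
      = D (coordField u w) u (gamma u (changeDefect L D D' ζ u v (eta u)))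
        - D (coordField u v) u (gamma u (changeDefect L D D' ζ u w (eta u))) := by
  have hcomm := hD'.cov_coordField_beta_comm hu v w
  rw [hζ.cov_coordField_beta_eq_sub_changeDefect hL hD hD' hLL' hu,
    hζ.cov_coordField_beta_eq_sub_changeDefect hL hD hD' hLL' hu,
    hD.cov_coordField_beta_comm hu v w, hL.metric_symm hu v w] at hcomm
  rw [← sub_eq_zero, ← sub_eq_zero.2 hcomm]
  abel

lemma IsConcurrent.changeDefect_skew (v w z : PiTM E M u) :
    metric L' u (changeDefect L D D' ζ u v w) z
      = -metric L' u (changeDefect L D D' ζ u v z) w := by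
  have hcompat := hD'.isMetric _ _ (isSmoothPiField_coordField u w) (isSmoothPiField_coordField u z)
    u hu (beta D u v)
  rw [hζ.mvfderiv_metric_change hL hD hLL' hu, hD.isMetric _ _ (isSmoothPiField_coordField u w)
    (isSmoothPiField_coordField u z) u hu, coordField_self, coordField_self,
    hD.isRegular.rho_beta hu, hζ.metric_symm_change hL hD hLL' hu w] at hcompat
  rw [hζ.metric_changeDefect hL hD hLL' hu, hζ.metric_changeDefect hL hD hLL' hu,
    hζ.metric_eq hL hD hLL' hu (D (coordField u w) u (beta D u v)) z,
    hζ.metric_eq hL hD hLL' hu (D (coordField u z) u (beta D u v)) w,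
    hL.metric_symm hu (D (coordField u z) u (beta D u v)) w]
  linarith

lemma IsConcurrent.changeDefect_eq_zero (v w : PiTM E M u) : changeDefect L D D' ζ u v w = 0 := by
  refine eq_zero_of_skew_of_torsion (T := fun v w ↦ D (coordField u w) u (gamma u v)) (η := eta u)
    (hζ.separatingLeft_metric_change hL hD hLL' hu) (fun v w z ↦ ?_) (fun w ↦ ?_) (fun v ↦ ?_)
    (hζ.changeDefect_skew hL hD hD' hLL' hu) (hζ.changeDefect_torsion hL hD hD' hLL' hu) v w
  · change metric L' u (D (coordField u w) u (gamma u v)) z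
      = metric L' u (D (coordField u z) u (gamma u v)) w
    rw [← hζ.cov_coordField_gamma_change hL hD hD' hLL' hu,
      ← hζ.cov_coordField_gamma_change hL hD hD' hLL' hu,
      hD'.metric_cov_coordField_gamma_swap hu]
  · rw [map_zero, map_zero]
  · rw [hD.cov_coordField_gamma_comm hL hu, hD.cov_coordField_gamma_eta hL hu]

lemma IsConcurrent.cov_coordField_change (w : PiTM E M u) (X : TangentSpace 𝓘(ℝ, E).tangent u) :
    D' (coordField u w) u X = D (coordField u w) u X
      - (metric L u (rho u X) w / (1 + metric L u (ζ u) (ζ u))) • ζ u := by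
  obtain ⟨v, hX⟩ := hD.isRegular.exists_eq_gamma_add_beta hu X
  calc D' (coordField u w) u X
      = D' (coordField u w) u (gamma u v) + D' (coordField u w) u (beta D u (rho u X)) := by
        rw [← map_add, ← hX]
    _ = D (coordField u w) u (gamma u v) + D (coordField u w) u (beta D u (rho u X))
        - (metric L u (rho u X) w / (1 + metric L u (ζ u) (ζ u))) • ζ u := by
        rw [hζ.cov_coordField_gamma_change hL hD hD' hLL' hu,
          cov_coordField_beta_eq_add_changeDefect L D D' ζ,
          hζ.changeDefect_eq_zero hL hD hD' hLL' hu, add_zero, add_sub_assoc]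
    _ = D (coordField u w) u X
        - (metric L u (rho u X) w / (1 + metric L u (ζ u) (ζ u))) • ζ u := by
        rw [← map_add, ← hX]

lemma IsConcurrent.cov_change {Y : Π u : TangentBundle 𝓘(ℝ, E) M, PiTM E M u}
    (hY : MDifferentiableAt 𝓘(ℝ, E).tangent (𝓘(ℝ, E).tangent.prod 𝓘(ℝ, E))
      (fun q ↦ (⟨q, Y q⟩ : TotalSpace E (PiTM E M))) u)
    (X : TangentSpace 𝓘(ℝ, E).tangent u) :
    D' Y u X = D Y u X
      - (metric L u (rho u X) (Y u) / (1 + metric L u (ζ u) (ζ u))) • ζ u := by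
  have hdiff := DFunLike.congr_fun (cov_sub_cov_eq hD.isConnection.isCovariantDerivativeOn
    hD'.isConnection.isCovariantDerivativeOn hu hY) X
  rw [sub_apply, sub_apply, hζ.cov_coordField_change hL hD hD' hLL' hu, sub_sub_cancel_left]
    at hdiff
  rw [sub_eq_iff_eq_add.1 hdiff, neg_add_eq_sub]

lemma IsConcurrent.beta_change (v : PiTM E M u) :
    beta D' u v = beta D u v
      + gamma u ((metric L u v (eta u) / (1 + metric L u (ζ u) (ζ u))) • ζ u) := by
  rw [hζ.beta_eq_add_gamma_sub_changeDefect hL hD hD' hLL' hu,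
    hζ.changeDefect_eq_zero hL hD hD' hLL' hu, sub_zero]

end Change

end Finsler

open Finsler in
theorem theorem3_general
    {E : Type*} [NormedAddCommGroup E] [NormedSpace ℝ E] [FiniteDimensional ℝ E]
    {M : Type*} [TopologicalSpace M] [T2Space M] [ChartedSpace E M] [IsManifold 𝓘(ℝ, E) ∞ M]
    {L L' : TangentBundle 𝓘(ℝ, E) M → ℝ} (hL : IsFinsler L) {D D' : PreConnection E M}
    (hD : IsCartanConnection L D) (hD' : IsCartanConnection L' D')
    {ζ : Π u : TangentBundle 𝓘(ℝ, E) M, PiTM E M u} (hζ : IsConcurrent D ζ)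
    (hLL' : ∀ u ∈ slit E M, L' u ^ 2 = L u ^ 2 + metric L u (ζ u) (eta u) ^ 2)
    {u : TangentBundle 𝓘(ℝ, E) M} (hu : u ∈ slit E M)
    {Y : Π u : TangentBundle 𝓘(ℝ, E) M, PiTM E M u}
    (hY : MDifferentiableAt 𝓘(ℝ, E).tangent (𝓘(ℝ, E).tangent.prod 𝓘(ℝ, E))
      (fun q ↦ (⟨q, Y q⟩ : TotalSpace E (PiTM E M))) u) :
    (∀ X, D' Y u X = D Y u X
      - (metric L u (rho u X) (Y u) / (1 + metric L u (ζ u) (ζ u))) • ζ u) ∧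
    (∀ v, D' Y u (gamma u v) = D Y u (gamma u v)) ∧
    (∀ v, D' Y u (beta D' u v) = D Y u (beta D u v) - horizontalChange L D ζ u v Y) := by
  have hcov := hζ.cov_change hL hD hD' hLL' hu hY
  refine ⟨hcov, fun v ↦ ?_, fun v ↦ ?_⟩
  · rw [hcov, rho_gamma, map_zero, zero_apply, zero_div, zero_smul, sub_zero]
  · rw [hcov, hD'.isRegular.rho_beta hu, hζ.beta_change hL hD hD' hLL' hu, map_add, map_smul,
      map_smul, horizontalChange]
    abel

theorem theorem3
    {E : Type*} [NormedAddCommGroup E] [NormedSpace ℝ E] [FiniteDimensional ℝ E]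
    {M : Type*} [TopologicalSpace M] [T2Space M] [ParacompactSpace M]
    [ChartedSpace E M] [IsManifold 𝓘(ℝ, E) ∞ M]
    (L L' : TangentBundle 𝓘(ℝ, E) M → ℝ)
    (hL : Finsler.IsFinsler L) (hL' : Finsler.IsFinsler L')
    (D D' : Finsler.PreConnection E M)
    (hD : Finsler.IsCartanConnection L D) (hD' : Finsler.IsCartanConnection L' D')
    (ζ : Π u : TangentBundle 𝓘(ℝ, E) M, Finsler.PiTM E M u)
    (hζ : Finsler.IsConcurrent D ζ)
    (hLL' : ∀ u ∈ Finsler.slit E M,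
      L' u ^ 2 = L u ^ 2 + (Finsler.metric L u (ζ u) (Finsler.eta u)) ^ 2) :
    (∀ Y : Π u : TangentBundle 𝓘(ℝ, E) M, TangentSpace 𝓘(ℝ, E).tangent u,
      Finsler.IsSmoothField Y →
      ∀ u ∈ Finsler.slit E M, ∀ X : TangentSpace 𝓘(ℝ, E).tangent u,
        D' (fun w ↦ Finsler.rho w (Y w)) u X
          = D (fun w ↦ Finsler.rho w (Y w)) u X
            - (Finsler.metric L u (Finsler.rho u X) (Finsler.rho u (Y u))
                / (1 + Finsler.metric L u (ζ u) (ζ u))) • ζ u) ∧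
    (∀ Y : Π u : TangentBundle 𝓘(ℝ, E) M, Finsler.PiTM E M u,
      Finsler.IsSmoothPiField Y →
      ∀ u ∈ Finsler.slit E M, ∀ v : Finsler.PiTM E M u,
        D' Y u (Finsler.gamma u v) = D Y u (Finsler.gamma u v)) ∧
    (∀ Y : Π u : TangentBundle 𝓘(ℝ, E) M, Finsler.PiTM E M u,
      Finsler.IsSmoothPiField Y →
      ∀ u ∈ Finsler.slit E M, ∀ v : Finsler.PiTM E M u,
        D' Y u (Finsler.beta D' u v)
          = D Y u (Finsler.beta D u v) - Finsler.horizontalChange L D ζ u v Y) := by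
  exact ⟨fun _ hY _ hu ↦ (theorem3_general hL hD hD' hζ hLL' hu (hY.mdifferentiableAt_rho hu)).1,
    fun _ hY _ hu ↦ (theorem3_general hL hD hD' hζ hLL' hu (hY.mdifferentiableAt hu)).2.1,
    fun _ hY _ hu ↦ (theorem3_general hL hD hD' hζ hLL' hu (hY.mdifferentiableAt hu)).2.2⟩
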